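/- Let $n\ge 4$ be an integer, let $\beta$ be a real number with $0<\beta\le\lfloor n/2\rfloor/n$, and put $N=\lfloor(2-\beta)n\rfloor$. Let $E(K_N)=E(R)\cup E(B)$ be a 2-colouring of the edges of the complete graph $K_N$, i.e. $R$ and $B$ are graphs on the vertex set $V=V(K_N)$ whose edge sets partition $E(K_N)$, and suppose that neither $R$ nor $B$ contains a (not necessarily induced) cycle $C_n$ of length $n$. Then there exist a vertex $u\in V$ and a partition $V=U_1\cup U_2\cup\{u\}$ into pairwise disjoint sets with $$(1-\beta)n-1<|U_1|\le|U_2|<n$$ such that, possibly after interchanging $R$ and $B$, $$E(R-u)=U_1^{(2)}\cup U_2^{(2)}\quad\text{and}\quad E(B-u)=U_1\times U_2 .$$ Here $G-u$ is the graph obtained from $G$ by deleting the vertex $u$, $U^{(2)}$ is the set of all 2-element subsets of $U$, and $U_1\times U_2$ is the set of all pairs $\{x,y\}$ with $x\in U_1$, $y\in U_2$. -/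

import Mathlib

namespace CycleRamsey

/-- `E(G) = E(R) ∪ E(B)` is a 2-colouring of the edges of `G`: the edge sets of the graphs `R`, `B`
on the same vertex set partition the edge set of `G`. -/
def IsTwoColoring {V : Type*} (G R B : SimpleGraph V) : Prop :=
  G.edgeSet = R.edgeSet ∪ B.edgeSet ∧ Disjoint R.edgeSet B.edgeSet

/-- The set `U^{(2)}` of all 2-element subsets of `U`. -/
def pairs {V : Type*} (U : Finset V) : Set (Sym2 V) :=
  {e | ∃ a ∈ U, ∃ b ∈ U, a ≠ b ∧ e = s(a, b)}

/-- The set `A × B` of all possible edges between `A` and `B`. -/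
def crossPairs {V : Type*} (A B : Finset V) : Set (Sym2 V) :=
  {e | ∃ a ∈ A, ∃ b ∈ B, e = s(a, b)}

/-- The edge set `E(G - u)`: the edges of `G` that avoid the vertex `u`. -/
def edgesAvoiding {V : Type*} (G : SimpleGraph V) (u : V) : Set (Sym2 V) :=
  {e | e ∈ G.edgeSet ∧ u ∉ e}

end CycleRamsey

namespace CycleRamsey

/-! ### Paths recorded by their vertex sets, and periodically indexed cycles. -/

section


variable {V : Type*} [DecidableEq V]

/-! Since `β n ≤ ⌊n/2⌋`, the complete graph has at least `3n/2` vertices. Apart from the lower bound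
on `U₁`, the structure follows from this and from the absence of a monochromatic `C_n`.

Some monochromatic cycle has length at least `n` (`exists_long_cycle`). Otherwise let a longest one
be red, of length `L < n`. At least `(L+3)/2` vertices lie off it. By maximality, any two of them
have about `L/2` common blue neighbours on the cycle (`IsCyc.rich`), and a red-connected set of them
is completely blue to half of the cycle (`IsCyc.exists_complete_half`). Alternating between the
cycle and its complement then yields a blue cycle longer than `L`; the parity of `L` is handled by
starting from a short blue path off the cycle.

Now let `L` be the least length at least `n` of a monochromatic cycle, say red. Then `L > n` and
length `L - 1` occurs in neither colour. If `L` is odd, chords of step 2 are blue and chords of step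
4 are red, which gives length `L - 1` after all; `L = 5` is done by hand. If `L = 2k`, both parity
classes of the cycle are blue cliques, and the blue edges between them pairwise meet, hence form a
star (`exists_cliques_of_even_cycle`, `exists_star_center`). Without the star's centre the red graph
between the classes is complete bipartite, so it contains `C_n` when `n` is even.

Hence `n = 2h + 1`, and the two blue cliques grow to cover all vertices but one
(`splits_of_cliques`): every deviation closes a monochromatic odd cycle of length `2h + 1`. A clique
has fewer than `n` vertices, which bounds the larger class and, by counting, the smaller one. -/

/-- `s` is the vertex set of a path of `G` from `a` to `b`. -/
def PathOn (G : SimpleGraph V) (s : Finset V) (a b : V) : Prop :=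
  ∃ l : List V, l.Nodup ∧ l.IsChain G.Adj ∧ l.toFinset = s ∧ l.head? = some a ∧
    l.getLast? = some b

/-- `v` runs periodically through the vertices of a cycle of length `L` of `G`. -/
structure IsCyc {V : Type*} (G : SimpleGraph V) (L : ℕ) (v : ℕ → V) : Prop where
  adj : ∀ i, G.Adj (v i) (v (i + 1))
  per : ∀ i, v (i + L) = v i
  ne : ∀ i j, i < j → j < i + L → v i ≠ v j

/-- `G` contains a cycle of length `L`. -/
def HasCycle {V : Type*} (G : SimpleGraph V) (L : ℕ) : Prop := ∃ v, IsCyc G L v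

theorem HasCycle.isContained {V : Type*} {G : SimpleGraph V} {n : ℕ}
    (h : HasCycle G n) : (SimpleGraph.cycleGraph n).IsContained G := by
  obtain ⟨v, hv⟩ := h
  have key : ∀ a b : Fin n, (a - b).val = 1 → G.Adj (v a) (v b) := by
    intro a b hab
    have ha := a.isLt
    have hb := b.isLt
    rw [Fin.val_sub] at hab
    rcases Nat.lt_or_ge a.val b.val with h | h
    · rw [Nat.mod_eq_of_lt (by omega)] at hab
      have h1 := hv.adj b
      rwa [show b.val + 1 = 0 + n by omega, hv.per, show 0 = a.val by omega,
        SimpleGraph.adj_comm] at h1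
    · rw [show n - b.val + a.val = (a.val - b.val) + n by omega, Nat.add_mod_right,
        Nat.mod_eq_of_lt (by omega)] at hab
      have h1 := hv.adj b
      rwa [show b.val + 1 = a.val by omega, SimpleGraph.adj_comm] at h1
  refine ⟨⟨⟨fun i => v i, ?_⟩, ?_⟩⟩
  · intro a b hab
    rw [SimpleGraph.cycleGraph_adj'] at hab
    rcases hab with h | h
    · exact key a b h
    · exact (key b a h).symm
  · intro a b hab
    by_contra hne
    have ha := a.isLt
    have hb := b.isLt
    rcases Nat.lt_or_gt_of_ne (fun h => hne (Fin.ext h)) with h | h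
    · exact hv.ne a b h (by omega) hab
    · exact hv.ne b a h (by omega) hab.symm

namespace PathOn

variable {G : SimpleGraph V} {s t : Finset V} {a b c d : V}

theorem single (G : SimpleGraph V) (a : V) : PathOn G {a} a a :=
  ⟨[a], by simp, by simp, by simp, by simp, by simp⟩

theorem symm (h : PathOn G s a b) : PathOn G s b a := by
  obtain ⟨l, h1, h2, h3, h4, h5⟩ := h
  refine ⟨l.reverse, by simpa using h1, ?_, by simpa using h3, by simpa using h5, by simpa using h4⟩
  rw [List.isChain_reverse]
  exact h2.imp fun _ _ h => h.symm

theorem append (h : PathOn G s a b) (h' : PathOn G t c d) (hst : Disjoint s t)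
    (hbc : G.Adj b c) : PathOn G (s ∪ t) a d := by
  obtain ⟨l, h1, h2, h3, h4, h5⟩ := h
  obtain ⟨l', h1', h2', h3', h4', h5'⟩ := h'
  refine ⟨l ++ l', ?_, ?_, by simp [h3, h3'], by simp [h4], by simp [h5']⟩
  · rw [List.nodup_append']
    refine ⟨h1, h1', ?_⟩
    intro x hx hx'
    rw [← h3, ← h3', Finset.disjoint_left] at hst
    exact hst (by simpa using hx) (by simpa using hx')
  · rw [List.isChain_append]
    refine ⟨h2, h2', ?_⟩
    intro x hx y hy
    rw [h5] at hx
    rw [h4'] at hy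
    simp at hx hy
    subst hx hy
    exact hbc

theorem snoc (h : PathOn G s a b) (hc : c ∉ s) (hbc : G.Adj b c) : PathOn G (insert c s) a c := by
  rw [Finset.insert_eq, Finset.union_comm]
  exact h.append (single G c) (by simpa using hc) hbc

theorem cons (h : PathOn G s a b) (hc : c ∉ s) (hca : G.Adj c a) : PathOn G (insert c s) c b :=
  (h.symm.snoc hc hca.symm).symm

theorem left_mem (h : PathOn G s a b) : a ∈ s := by
  obtain ⟨l, h1, h2, h3, h4, h5⟩ := h
  rw [← h3, List.mem_toFinset]
  exact List.mem_of_head? h4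

theorem right_mem (h : PathOn G s a b) : b ∈ s := h.symm.left_mem

/-- The list is read modulo its length; the edge from `b` to `a` serves exactly the wrap-around
step. -/
theorem hasCycle (h : PathOn G s a b) (hba : G.Adj b a) : HasCycle G s.card := by
  obtain ⟨l, h1, h2, h3, h4, h5⟩ := h
  have hl : s.card = l.length := by rw [← h3, List.toFinset_card_of_nodup h1]
  have h0 : l ≠ [] := by rintro rfl; simp at h4
  have hpos : 0 < l.length := List.length_pos_of_ne_nil h0
  rw [hl]
  refine ⟨fun i => l[i % l.length]'(Nat.mod_lt _ hpos), ?_, ?_, ?_⟩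
  · intro i
    have hi := Nat.mod_lt i hpos
    by_cases hlt : i % l.length + 1 < l.length
    · have : (i + 1) % l.length = i % l.length + 1 := by
        rw [Nat.add_mod, Nat.mod_eq_of_lt (show 1 < l.length by omega), Nat.mod_eq_of_lt hlt]
      simp only [this]
      exact List.isChain_iff_getElem.1 h2 _ hlt
    · have e : i % l.length = l.length - 1 := by omega
      have : (i + 1) % l.length = 0 := by
        rw [← Nat.mod_add_mod, e, Nat.sub_add_cancel hpos, Nat.mod_self]
      simp only [this, e]
      rw [List.getLast?_eq_getElem?, List.getElem?_eq_getElem (by omega)] at h5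
      rw [List.head?_eq_getElem?, List.getElem?_eq_getElem (by omega)] at h4
      simp only [Option.some.injEq] at h4 h5
      rw [h4, h5]
      exact hba
  · intro i
    simp
  · intro i j hij hj he
    have := (h1.getElem_inj_iff).1 he
    have h6 : i ≡ j [MOD l.length] := this
    rw [Nat.modEq_iff_dvd' hij.le] at h6
    exact absurd (Nat.le_of_dvd (by omega) h6) (by omega)

end PathOn

namespace IsCyc

variable {G : SimpleGraph V} {L : ℕ} {v : ℕ → V}

theorem shift {V : Type*} {G : SimpleGraph V} {L : ℕ} {v : ℕ → V} (hv : IsCyc G L v) (k : ℕ) : IsCyc G L (fun i => v (i + k)) :=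
  ⟨fun i => by rw [Nat.add_right_comm]; exact hv.adj _,
    fun i => by rw [Nat.add_right_comm]; exact hv.per _,
    fun i j h h' => hv.ne _ _ (by omega) (by omega)⟩

/-- Periodic indexing lets `j` exceed `L`, so arcs across the base point need no special treatment.
-/
theorem path (hv : IsCyc G L v) {i j : ℕ} (hij : i ≤ j) (hj : j < i + L) :
    PathOn G ((Finset.Icc i j).image v) (v i) (v j) := by
  induction j, hij using Nat.le_induction with
  | base => simpa using PathOn.single G (v i)
  | succ j hij ih =>
    have := (ih (by omega)).snoc (c := v (j + 1)) ?_ (hv.adj j)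
    · rwa [← Finset.image_insert, Finset.insert_Icc_right_eq_Icc_add_one (by omega)] at this
    · simp only [Finset.mem_image, Finset.mem_Icc, not_exists, not_and]
      intro x hx
      exact hv.ne _ _ (by omega) (by omega)

theorem card_image (hv : IsCyc G L v) {i j : ℕ} (hj : j < i + L) :
    ((Finset.Icc i j).image v).card = j + 1 - i := by
  rw [Finset.card_image_of_injOn, Nat.card_Icc]
  intro x hx y hy hxy
  simp at hx hy
  by_contra hne
  rcases Nat.lt_or_gt_of_ne hne with h | h
  · exact hv.ne _ _ h (by omega) hxy
  · exact hv.ne _ _ h (by omega) hxy.symm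

theorem disjoint_image (hv : IsCyc G L v) {i j i' j' : ℕ} (h : j < i') (hj : j' < i + L) :
    Disjoint ((Finset.Icc i j).image v) ((Finset.Icc i' j').image v) := by
  rw [Finset.disjoint_left]
  simp only [Finset.mem_image, Finset.mem_Icc, not_exists, not_and]
  rintro _ ⟨x, hx, rfl⟩ y hy
  exact (hv.ne _ _ (by omega) (by omega)).symm

end IsCyc

end

/-! ### Building cycles by alternation through common neighbours and through cliques. -/

section


variable {V : Type*} [DecidableEq V] {G : SimpleGraph V}

/-- Any two distinct vertices of `W` have at least `c` common neighbours in `C`. -/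
def Rich {V : Type*} (G : SimpleGraph V) (W C : Finset V) (c : ℕ) : Prop :=
  ∀ x ∈ W, ∀ y ∈ W, x ≠ y → ∀ F : Finset V, F.card < c →
    ∃ z ∈ C, z ∉ F ∧ G.Adj x z ∧ G.Adj z y

theorem Rich.of_complete {V : Type*} {G : SimpleGraph V} {W C : Finset V}
    (h : ∀ x ∈ W, ∀ y ∈ C, G.Adj x y) : Rich G W C C.card := by
  intro x hx y hy _ F hF
  obtain ⟨z, hz, hzF⟩ := Finset.exists_mem_notMem_of_card_lt_card hF
  exact ⟨z, hz, hzF, h x hx z hz, (h y hy z hz).symm⟩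

/-- Extend a path through all vertices of `K`, bridging the gaps by vertices of `C`. -/
theorem Rich.extend {W C : Finset V} {c : ℕ} (hr : Rich G W C c) (hWC : Disjoint W C)
    (K : Finset V) : ∀ {s : Finset V} {a b : V}, PathOn G s a b → b ∈ W → K ⊆ W → Disjoint K s →
    (s ∩ C).card + K.card ≤ c →
    ∃ s' b', PathOn G s' a b' ∧ b' ∈ W ∧ (b' ∈ K ∨ K = ∅ ∧ b' = b) ∧ s ⊆ s' ∧
      s'.card = s.card + 2 * K.card ∧ (s' ∩ C).card = (s ∩ C).card + K.card ∧
      s' ⊆ s ∪ K ∪ C := by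
  induction K using Finset.induction_on with
  | empty =>
    intro s a b hp hb _ _ _
    exact ⟨s, b, hp, hb, Or.inr ⟨rfl, rfl⟩, subset_rfl, by simp, by simp, by simp⟩
  | insert k K hk ih =>
    intro s a b hp hb hKW hKs hc
    rw [Finset.card_insert_of_notMem hk] at hc
    rw [Finset.insert_subset_iff] at hKW
    rw [Finset.disjoint_insert_left] at hKs
    have hbk : b ≠ k := by rintro rfl; exact hKs.1 hp.right_mem
    -- Greedy choice: only the vertices of `C` already on the path are forbidden as bridges.
    obtain ⟨z, hzC, hzs, hbz, hzk⟩ := hr b hb k hKW.1 hbk (s ∩ C) (by omega)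
    have hzs' : z ∉ s := fun h => hzs (Finset.mem_inter.2 ⟨h, hzC⟩)
    have hkC : k ∉ C := Finset.disjoint_left.1 hWC hKW.1
    have hkz : k ∉ insert z s := by
      rw [Finset.mem_insert, not_or]
      exact ⟨fun h => hkC (h ▸ hzC), hKs.1⟩
    have hp' := (hp.snoc hzs' hbz).snoc hkz hzk
    have hcard : (insert k (insert z s)).card = s.card + 2 := by
      rw [Finset.card_insert_of_notMem hkz, Finset.card_insert_of_notMem hzs']
    have hcardC : (insert k (insert z s) ∩ C).card = (s ∩ C).card + 1 := by
      rw [Finset.insert_inter_of_notMem hkC, Finset.insert_inter_of_mem hzC,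
        Finset.card_insert_of_notMem hzs]
    have hdis : Disjoint K (insert k (insert z s)) := by
      rw [Finset.disjoint_insert_right, Finset.disjoint_insert_right]
      exact ⟨hk, fun h => Finset.disjoint_left.1 hWC (hKW.2 h) hzC, hKs.2⟩
    obtain ⟨s', b', h1, h2, h3, h4, h5, h6, h7⟩ := ih hp' hKW.1 hKW.2 hdis (by omega)
    refine ⟨s', b', h1, h2, Or.inl ?_, ?_, ?_, ?_, ?_⟩
    · rcases h3 with h3 | h3
      · exact Finset.mem_insert_of_mem h3
      · rw [h3.2]; exact Finset.mem_insert_self _ _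
    · exact fun x hx => h4 (by simp [hx])
    · rw [h5, hcard, Finset.card_insert_of_notMem hk]; omega
    · rw [h6, hcardC, Finset.card_insert_of_notMem hk]; omega
    · intro x hx
      have := h7 hx
      simp only [Finset.mem_union, Finset.mem_insert] at this ⊢
      rcases this with ((rfl | rfl | h) | h) | h <;> simp_all

/-- After all of `K` is absorbed, one more bridge in `C` joins the two ends, whence both occurrences
of `+ 1`. The alternative `hab` keeps these ends distinct, as `Rich` demands. -/
theorem Rich.hasCycle {W C K s : Finset V} {c : ℕ} {a b : V} (hr : Rich G W C c)
    (hWC : Disjoint W C) (hp : PathOn G s a b) (ha : a ∈ W) (hb : b ∈ W) (hK : K ⊆ W)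
    (hKs : Disjoint K s) (hab : a ≠ b ∨ K.Nonempty) (hc : (s ∩ C).card + K.card + 1 ≤ c) :
    HasCycle G (s.card + 2 * K.card + 1) := by
  obtain ⟨s', b', h1, h2, h3, h4, h5, h6, h7⟩ := hr.extend hWC K hp hb hK hKs (by omega)
  have hne : b' ≠ a := by
    rcases h3 with h3 | ⟨h3, rfl⟩
    · rintro rfl
      exact Finset.disjoint_left.1 hKs h3 hp.left_mem
    · rcases hab with h | h
      · exact h.symm
      · simp [h3] at h
  obtain ⟨z, hzC, hzs, hbz, hza⟩ := hr b' h2 a ha hne (s' ∩ C) (by omega)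
  have hzs' : z ∉ s' := fun h => hzs (Finset.mem_inter.2 ⟨h, hzC⟩)
  have := (h1.snoc hzs' hbz).hasCycle hza
  rwa [Finset.card_insert_of_notMem hzs', h5] at this

/-- As `Rich.hasCycle`, with `K` chosen by its cardinality. -/
theorem Rich.hasCycle_of_card {W C s : Finset V} {c m : ℕ} {a b : V} (hr : Rich G W C c)
    (hWC : Disjoint W C) (hp : PathOn G s a b) (ha : a ∈ W) (hb : b ∈ W)
    (hm : m ≤ (W \ s).card) (hab : a ≠ b ∨ 0 < m) (hc : (s ∩ C).card + m + 1 ≤ c) :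
    HasCycle G (s.card + 2 * m + 1) := by
  obtain ⟨K, hK, rfl⟩ := Finset.exists_subset_card_eq hm
  have hK' := Finset.subset_sdiff.1 hK
  exact hr.hasCycle hWC hp ha hb hK'.1 hK'.2 (hab.imp id Finset.card_pos.1) hc

/-- A complete bipartite graph contains all even cycles that fit into it. -/
theorem hasCycle_of_complete_bipartite {P Q : Finset V} {m : ℕ} (hm : 2 ≤ m) (hP : m ≤ P.card)
    (hQ : m ≤ Q.card) (hPQ : Disjoint P Q) (h : ∀ x ∈ P, ∀ y ∈ Q, G.Adj x y) :
    HasCycle G (2 * m) := by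
  obtain ⟨p, hp⟩ := Finset.card_pos.1 (show 0 < P.card by omega)
  have := (Rich.of_complete h).hasCycle_of_card (m := m - 1) hPQ (PathOn.single G p) hp hp
    (by rw [Finset.card_sdiff_of_subset (by simpa using hp), Finset.card_singleton]; omega)
    (Or.inr (by omega))
    (by rw [Finset.singleton_inter_of_notMem (Finset.disjoint_left.1 hPQ hp),
          Finset.card_empty]; omega)
  rwa [Finset.card_singleton, show 1 + 2 * (m - 1) + 1 = 2 * m by omega] at this

theorem exists_pathOn_of_clique {s : Finset V} (hs : s.Nonempty)
    (h : ∀ x ∈ s, ∀ y ∈ s, x ≠ y → G.Adj x y) : ∃ a ∈ s, ∃ b ∈ s, PathOn G s a b := by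
  induction hs using Finset.Nonempty.cons_induction with
  | singleton a => exact ⟨a, by simp, a, by simp, PathOn.single G a⟩
  | cons a s ha hs ih =>
    obtain ⟨x, hx, y, hy, hp⟩ := ih fun x hx y hy =>
      h x (Finset.mem_cons_of_mem hx) y (Finset.mem_cons_of_mem hy)
    refine ⟨a, by simp, y, by simp [hy], ?_⟩
    rw [Finset.cons_eq_insert]
    exact hp.cons ha (h a (by simp) x (by simp [hx]) (by rintro rfl; exact ha hx))

theorem hasCycle_of_clique {A : Finset V} {n : ℕ} (hn : 2 ≤ n) (hA : n ≤ A.card)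
    (h : ∀ x ∈ A, ∀ y ∈ A, x ≠ y → G.Adj x y) : HasCycle G n := by
  obtain ⟨s, hs, rfl⟩ := Finset.exists_subset_card_eq hA
  obtain ⟨a, ha⟩ := Finset.card_pos.1 (show 0 < s.card by omega)
  obtain ⟨x, hx, y, hy, hp⟩ := exists_pathOn_of_clique (G := G) (s := s.erase a)
    (by rw [← Finset.card_pos, Finset.card_erase_of_mem ha]; omega)
    fun x hx y hy => h x (hs (Finset.mem_of_mem_erase hx)) y (hs (Finset.mem_of_mem_erase hy))
  have := (hp.snoc (Finset.notMem_erase a s)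
    (h y (hs (Finset.mem_of_mem_erase hy)) a (hs ha) (Finset.ne_of_mem_erase hy))).hasCycle
    (h a (hs ha) x (hs (Finset.mem_of_mem_erase hx)) (Finset.ne_of_mem_erase hx).symm)
  rwa [Finset.insert_erase ha] at this

/-- Paths with `r` inner vertices in a clique `A` between two vertices joined to all of `A`. -/
theorem exists_pathOn_through_clique {A : Finset V} {a b : V} {r : ℕ}
    (h : ∀ x ∈ A, ∀ y ∈ A, x ≠ y → G.Adj x y) (ha : ∀ x ∈ A, x ≠ a → G.Adj a x)
    (hb : ∀ x ∈ A, x ≠ b → G.Adj b x) (hab : a ≠ b) (hr : r + 2 ≤ (insert a (insert b A)).card)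
    (h0 : 0 < r ∨ G.Adj a b) :
    ∃ s ⊆ insert a (insert b A), PathOn G s a b ∧ s.card = r + 2 := by
  rcases Nat.eq_zero_or_pos r with rfl | hpos
  · refine ⟨{b, a}, ?_, (PathOn.single G a).snoc (by simpa using hab.symm) (by simpa using h0),
      Finset.card_pair hab.symm⟩
    intro x
    simp only [Finset.mem_insert, Finset.mem_singleton]
    tauto
  · have hr' : r ≤ ((A.erase a).erase b).card := by
      have h1 : insert a (insert b A) = insert a (insert b ((A.erase a).erase b)) := by
        ext x
        simp only [Finset.mem_insert, Finset.mem_erase]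
        tauto
      rw [h1] at hr
      have h2 := Finset.card_insert_le a (insert b ((A.erase a).erase b))
      have h3 := Finset.card_insert_le b ((A.erase a).erase b)
      omega
    obtain ⟨t, ht, rfl⟩ := Finset.exists_subset_card_eq hr'
    have ht' : ∀ x ∈ t, x ≠ b ∧ x ≠ a ∧ x ∈ A := fun x hx => by simpa using ht hx
    obtain ⟨x, hx, y, hy, hp⟩ := exists_pathOn_of_clique (G := G) (Finset.card_pos.1 hpos)
      fun x hx y hy => h x (ht' x hx).2.2 y (ht' y hy).2.2
    have hat : a ∉ t := fun h => (ht' a h).2.1 rfl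
    have hbt : b ∉ t := fun h => (ht' b h).1 rfl
    have hbt' : b ∉ insert a t := by simp [hbt, hab.symm]
    refine ⟨insert b (insert a t), ?_, (hp.cons hat (ha x (ht' x hx).2.2 (ht' x hx).2.1)).snoc hbt'
      (hb y (ht' y hy).2.2 (ht' y hy).1).symm, ?_⟩
    · intro z hz
      simp only [Finset.mem_insert] at hz ⊢
      rcases hz with rfl | rfl | hz
      · simp
      · simp
      · simp [(ht' z hz).2.2]
    · rw [Finset.card_insert_of_notMem hbt', Finset.card_insert_of_notMem hat]

/-- Two disjoint edges between two cliques close cycles of all lengths in a range. -/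
theorem hasCycle_of_two_cross {A B : Finset V} {a a' b b' : V} {p q : ℕ}
    (hA : ∀ x ∈ A, ∀ y ∈ A, x ≠ y → G.Adj x y) (hB : ∀ x ∈ B, ∀ y ∈ B, x ≠ y → G.Adj x y)
    (ha : ∀ x ∈ A, x ≠ a → G.Adj a x) (ha' : ∀ x ∈ A, x ≠ a' → G.Adj a' x)
    (hb : ∀ x ∈ B, x ≠ b → G.Adj b x) (hb' : ∀ x ∈ B, x ≠ b' → G.Adj b' x)
    (hd : Disjoint (insert a (insert a' A)) (insert b (insert b' B)))
    (haa : a ≠ a') (hbb : b ≠ b') (hab : G.Adj a b) (hab' : G.Adj a' b')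
    (hp : p + 2 ≤ (insert a (insert a' A)).card) (hq : q + 2 ≤ (insert b (insert b' B)).card)
    (hp0 : 0 < p ∨ G.Adj a a') (hq0 : 0 < q ∨ G.Adj b b') : HasCycle G (p + q + 4) := by
  obtain ⟨s, hs, hps, hsc⟩ := exists_pathOn_through_clique hA ha ha' haa hp hp0
  obtain ⟨t, ht, hpt, htc⟩ := exists_pathOn_through_clique hB hb hb' hbb hq hq0
  have hdst : Disjoint s t := Finset.disjoint_of_subset_left hs (Finset.disjoint_of_subset_right ht hd)
  have := (hps.append hpt.symm hdst hab').hasCycle hab.symm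
  rwa [Finset.card_union_of_disjoint hdst, hsc, htc,
    show p + 2 + (q + 2) = p + q + 4 by omega] at this

end

/-! ### Shortening a cycle by one: what happens when length `L - 1` is missing in both colours. -/

section


variable {V : Type*} [DecidableEq V]

theorem IsCyc.mod_eq {V : Type*} {G : SimpleGraph V} {L : ℕ} {v : ℕ → V} (hv : IsCyc G L v)
    (hL : 0 < L) {i j : ℕ} (h : v i = v j) : i % L = j % L := by
  have hper : Function.Periodic v L := hv.per
  rw [← hper.map_mod_nat i, ← hper.map_mod_nat j] at h
  have hi := Nat.mod_lt i hL
  have hj := Nat.mod_lt j hL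
  by_contra hne
  rcases Nat.lt_or_gt_of_ne hne with h' | h'
  · exact hv.ne _ _ h' (by omega) h
  · exact hv.ne _ _ h' (by omega) h.symm

theorem IsCyc.ne_of_parity {V : Type*} {G : SimpleGraph V} {k : ℕ} {v : ℕ → V}
    (hv : IsCyc G (2 * k) v) (hk : 0 < k) (i j : ℕ) : v (2 * i) ≠ v (2 * j + 1) := by
  intro h
  have h1 := congrArg (· % 2) (hv.mod_eq (by omega) h)
  simp only [Nat.mod_mul_right_mod] at h1
  omega

/-- A chord of step 2 bypasses a single vertex. -/
theorem IsCyc.not_adj_add_two {G : SimpleGraph V} {L : ℕ} {v : ℕ → V} (hv : IsCyc G L v)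
    (hL : 2 ≤ L) (h : ¬ HasCycle G (L - 1)) (i : ℕ) : ¬ G.Adj (v i) (v (i + 2)) := by
  intro hadj
  apply h
  have := (hv.path (i := i + 2) (j := i + L) (by omega) (by omega)).hasCycle
    (by rw [hv.per]; exact hadj)
  rwa [hv.card_image (by omega), show i + L + 1 - (i + 2) = L - 1 by omega] at this

theorem IsCyc.adj_add_two {R B : SimpleGraph V} {L : ℕ} {v : ℕ → V} (hv : IsCyc R L v)
    (hc : ∀ x y, x ≠ y → R.Adj x y ∨ B.Adj x y)
    (hL : 3 ≤ L) (h : ¬ HasCycle R (L - 1)) (i : ℕ) : B.Adj (v i) (v (i + 2)) :=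
  (hc _ _ (hv.ne _ _ (by omega) (by omega))).resolve_left (hv.not_adj_add_two (by omega) h i)

/-- Doubling the steps of an odd cycle. -/
theorem IsCyc.double {V : Type*} {R B : SimpleGraph V} {L : ℕ} {v : ℕ → V} (hv : IsCyc R L v)
    (hodd : Odd L) (h : ∀ i, B.Adj (v i) (v (i + 2))) : IsCyc B L (fun i => v (2 * i)) := by
  refine ⟨fun i => h (2 * i), fun i => ?_, fun i j hij hj => ?_⟩
  · rw [show 2 * (i + L) = 2 * i + L + L by ring, hv.per, hv.per]
  · obtain ⟨k, hk⟩ := hodd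
    rcases Nat.lt_or_ge (2 * j) (2 * i + L) with h1 | h1
    · exact hv.ne _ _ (by omega) h1
    · rw [show 2 * j = (2 * j - L) + L by omega, hv.per]
      exact hv.ne _ _ (by omega) (by omega)

/-- If length `L - 1` were missing, chords of step 2 would lie in `B` and, `L` being odd, form a
`B`-cycle of length `L`. Its own chords of step 2 would lie in `R`, so all chords of step 4 are in
`R`; three of them reroute the original cycle past one vertex. -/
theorem hasCycle_pred_of_odd {R B : SimpleGraph V} (hc : ∀ x y, x ≠ y → R.Adj x y ∨ B.Adj x y)
    {L : ℕ} (hodd : Odd L) (hL : 7 ≤ L) (h : HasCycle R L) :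
    HasCycle R (L - 1) ∨ HasCycle B (L - 1) := by
  obtain ⟨v, hv⟩ := h
  by_contra! hno
  have hu := hv.double hodd (hv.adj_add_two hc (by omega) hno.1)
  have h4' := hu.adj_add_two (fun x y hxy => (hc x y hxy).symm) (by omega) hno.2
  have h4 : ∀ i, R.Adj (v i) (v (i + 4)) := by
    intro i
    rcases Nat.even_or_odd i with ⟨j, hj⟩ | hi
    · have := h4' j
      rwa [show 2 * j = i by omega, show 2 * (j + 2) = i + 4 by omega] at this
    · obtain ⟨j, hj⟩ := hi.add_odd hodd
      have := h4' j
      rwa [show 2 * j = i + L by omega, show 2 * (j + 2) = i + 4 + L by omega, hv.per,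
        hv.per] at this
  -- The cycle is `v 2, …, v (L-4), v L, v (L+1), v (L-3), v (L-2)`, closed at `v 2`; it omits only
  -- `v (L-1)`.
  apply hno.1
  have p1 := hv.path (i := 2) (j := L - 4) (by omega) (by omega)
  have p2 := hv.path (i := L - 3) (j := L - 2) (by omega) (by omega)
  have p3 := hv.path (i := L) (j := L + 1) (by omega) (by omega)
  have d13 := hv.disjoint_image (i := 2) (j := L - 4) (i' := L) (j' := L + 1) (by omega) (by omega)
  have d12 := hv.disjoint_image (i := 2) (j := L - 4) (i' := L - 3) (j' := L - 2)
    (by omega) (by omega)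
  have d23 := hv.disjoint_image (i := L - 3) (j := L - 2) (i' := L) (j' := L + 1)
    (by omega) (by omega)
  have a1 : R.Adj (v (L - 4)) (v L) := by
    have := h4 (L - 4)
    rwa [show L - 4 + 4 = L by omega] at this
  have a2 : R.Adj (v (L + 1)) (v (L - 3)) := by
    have := h4 (L - 3)
    rw [show L - 3 + 4 = L + 1 by omega] at this
    exact this.symm
  have a3 : R.Adj (v (L - 2)) (v 2) := by
    have := h4 (L - 2)
    rwa [show L - 2 + 4 = 2 + L by omega, hv.per] at this
  have := ((p1.append p3 d13 a1).append p2 (Finset.disjoint_union_left.2 ⟨d12, d23.symm⟩)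
    a2).hasCycle a3
  rwa [Finset.card_union_of_disjoint (Finset.disjoint_union_left.2 ⟨d12, d23.symm⟩),
    Finset.card_union_of_disjoint d13, hv.card_image (by omega), hv.card_image (by omega),
    hv.card_image (by omega), show L - 4 + 1 - 2 + (L + 1 + 1 - L) + (L - 2 + 1 - (L - 3)) = L - 1
      by omega] at this

theorem IsCyc.half {V : Type*} {R B : SimpleGraph V} {k : ℕ} {v : ℕ → V} (hv : IsCyc R (2 * k) v)
    (h : ∀ i, B.Adj (v i) (v (i + 2))) : IsCyc B k (fun i => v (2 * i)) := by
  refine ⟨fun i => h (2 * i), fun i => ?_, fun i j hij hj => hv.ne _ _ (by omega) (by omega)⟩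
  rw [show 2 * (i + k) = 2 * i + 2 * k by ring, hv.per]

/-- An even chord in `R` would force two edges of `B` between the parity classes. The steps of
length 2 form two `B`-cycles of length `k`, and the two edges splice all of one with all but one
vertex of the other. -/
theorem IsCyc.not_adj_even_chord {R B : SimpleGraph V}
    (hc : ∀ x y, x ≠ y → R.Adj x y ∨ B.Adj x y) {k : ℕ} (hk : 3 ≤ k)
    (hR : ¬ HasCycle R (2 * k - 1)) (hB : ¬ HasCycle B (2 * k - 1)) {v : ℕ → V}
    (hv : IsCyc R (2 * k) v) {m : ℕ} (hm : 2 ≤ m) (hmk : m + 2 ≤ k) :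
    ¬ R.Adj (v 0) (v (2 * m)) := by
  intro hadj
  have h2 := hv.adj_add_two hc (by omega) hR
  have hL : v (2 * k) = v 0 := by simpa using hv.per 0
  -- In `R`, this edge and the chord would give a cycle through every vertex except `v (2 * m + 1)`;
  -- for `b2` below the omitted vertex is `v (2 * m - 1)`.
  have b1 : B.Adj (v 1) (v (2 * m + 2)) := by
    refine (hc _ _ (hv.ne _ _ (by omega) (by omega))).resolve_left fun hr => hR ?_
    have p1 := hv.path (i := 1) (j := 2 * m) (by omega) (by omega)
    have p2 := hv.path (i := 2 * m + 2) (j := 2 * k) (by omega) (by omega)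
    have d := hv.disjoint_image (i := 1) (j := 2 * m) (i' := 2 * m + 2) (j' := 2 * k)
      (by omega) (by omega)
    have := (p1.append p2.symm d (by rw [hL]; exact hadj.symm)).hasCycle hr.symm
    rwa [Finset.card_union_of_disjoint d, hv.card_image (by omega), hv.card_image (by omega),
      show 2 * m + 1 - 1 + (2 * k + 1 - (2 * m + 2)) = 2 * k - 1 by omega] at this
  have b2 : B.Adj (v (2 * m - 2)) (v (2 * k - 1)) := by
    refine (hc _ _ (hv.ne _ _ (by omega) (by omega))).resolve_left fun hr => hR ?_
    have p1 := hv.path (i := 0) (j := 2 * m - 2) (by omega) (by omega)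
    have p2 := hv.path (i := 2 * m) (j := 2 * k - 1) (by omega) (by omega)
    have d := hv.disjoint_image (i := 0) (j := 2 * m - 2) (i' := 2 * m) (j' := 2 * k - 1)
      (by omega) (by omega)
    have := (p1.append p2.symm d hr).hasCycle hadj.symm
    rwa [Finset.card_union_of_disjoint d, hv.card_image (by omega), hv.card_image (by omega),
      show 2 * m - 2 + 1 - 0 + (2 * k - 1 + 1 - 2 * m) = 2 * k - 1 by omega] at this
  have hE := hv.half h2
  have hO := (hv.shift 1).half fun i => by
    have := h2 (i + 1)
    rwa [show i + 1 + 2 = i + 2 + 1 by omega] at this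
  -- All even positions except `2 * m`, from `2 * m + 2` round to `2 * m - 2`; `pO` takes all odd
  -- positions.
  have pE := hE.path (i := m + 1) (j := m - 1 + k) (by omega) (by omega)
  have pO := hO.path (i := 0) (j := k - 1) (by omega) (by omega)
  have d : Disjoint ((Finset.Icc (m + 1) (m - 1 + k)).image fun i => v (2 * i))
      ((Finset.Icc 0 (k - 1)).image fun i => v (2 * i + 1)) := by
    rw [Finset.disjoint_left]
    simp only [Finset.mem_image, not_exists, not_and]
    rintro _ ⟨i, -, rfl⟩ j -
    exact (hv.ne_of_parity (by omega) i j).symm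
  apply hB
  have := (pE.append pO.symm d ?_).hasCycle ?_
  · rwa [Finset.card_union_of_disjoint d, hE.card_image (by omega), hO.card_image (by omega),
      show m - 1 + k + 1 - (m + 1) + (k - 1 + 1 - 0) = 2 * k - 1 by omega] at this
  · rwa [show 2 * (m - 1 + k) = 2 * m - 2 + 2 * k by omega, hv.per,
      show 2 * (k - 1) + 1 = 2 * k - 1 by omega]
  · exact b1

/-- The classes are the even and the odd positions; all chords inside a class are in `B`. Two
disjoint `B`-edges between these cliques would close a `B`-cycle of length `2k - 1`. -/
theorem exists_cliques_of_even_cycle {R B : SimpleGraph V}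
    (hc : ∀ x y, x ≠ y → R.Adj x y ∨ B.Adj x y) {k : ℕ} (hk : 3 ≤ k)
    (h : HasCycle R (2 * k)) (hR : ¬ HasCycle R (2 * k - 1)) (hB : ¬ HasCycle B (2 * k - 1)) :
    ∃ E O : Finset V, Disjoint E O ∧ E.card = k ∧ O.card = k ∧
      (∀ x ∈ E, ∀ y ∈ E, x ≠ y → B.Adj x y) ∧ (∀ x ∈ O, ∀ y ∈ O, x ≠ y → B.Adj x y) ∧
      ∀ a ∈ E, ∀ a' ∈ E, ∀ b ∈ O, ∀ b' ∈ O, a ≠ a' → b ≠ b' → B.Adj a b → ¬ B.Adj a' b' := by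
  obtain ⟨v, hv⟩ := h
  have h2 := hv.adj_add_two hc (by omega) hR
  have chord : ∀ i d, 0 < d → d < k → B.Adj (v i) (v (i + 2 * d)) := by
    intro i d hd hdk
    rcases eq_or_ne d 1 with rfl | h1
    · exact h2 i
    -- Here the chord has step 2 when measured the other way round.
    rcases eq_or_ne (d + 1) k with h1 | h1'
    · have := h2 (i + 2 * d)
      rw [show i + 2 * d + 2 = i + 2 * k by omega, hv.per] at this
      exact this.symm
    · refine (hc _ _ (hv.ne _ _ (by omega) (by omega))).resolve_left ?_
      have := (hv.shift i).not_adj_even_chord hc hk hR hB (m := d) (by omega) (by omega)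
      simpa [add_comm] using this
  have clique : ∀ o, ∀ x ∈ (Finset.range k).image (fun i => v (2 * i + o)),
      ∀ y ∈ (Finset.range k).image (fun i => v (2 * i + o)), x ≠ y → B.Adj x y := by
    intro o x hx y hy hxy
    simp only [Finset.mem_image, Finset.mem_range] at hx hy
    obtain ⟨i, hi, rfl⟩ := hx
    obtain ⟨j, hj, rfl⟩ := hy
    have hij : i ≠ j := by rintro rfl; exact hxy rfl
    rcases Nat.lt_or_gt_of_ne hij with h | h
    · have := chord (2 * i + o) (j - i) (by omega) (by omega)
      rwa [show 2 * i + o + 2 * (j - i) = 2 * j + o by omega] at this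
    · have := chord (2 * j + o) (i - j) (by omega) (by omega)
      rw [show 2 * j + o + 2 * (i - j) = 2 * i + o by omega] at this
      exact this.symm
  have card : ∀ o, ((Finset.range k).image (fun i => v (2 * i + o))).card = k := by
    intro o
    rw [Finset.card_image_of_injOn, Finset.card_range]
    intro i hi j hj hij
    simp only [Finset.coe_range, Set.mem_Iio] at hi hj
    by_contra hne
    rcases Nat.lt_or_gt_of_ne hne with h | h
    · exact hv.ne _ _ (by omega) (by omega) hij
    · exact hv.ne _ _ (by omega) (by omega) hij.symm
  have hd : Disjoint ((Finset.range k).image (fun i => v (2 * i + 0)))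
      ((Finset.range k).image (fun i => v (2 * i + 1))) := by
    rw [Finset.disjoint_left]
    simp only [Finset.mem_image, not_exists, not_and]
    rintro _ ⟨i, -, rfl⟩ j -
    exact (hv.ne_of_parity (by omega) i j).symm
  refine ⟨_, _, hd, card 0, card 1, clique 0, clique 1, ?_⟩
  intro a ha a' ha' b hb b' hb' haa hbb hab hab'
  apply hB
  have eA := Finset.insert_eq_of_mem ha
  have eA' := Finset.insert_eq_of_mem ha'
  have eB := Finset.insert_eq_of_mem hb
  have eB' := Finset.insert_eq_of_mem hb'
  -- All `k` vertices of one clique and `k - 1` of the other.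
  have := hasCycle_of_two_cross (p := k - 2) (q := k - 3) (clique 0) (clique 1)
    (fun x hx h => clique 0 a ha x hx h.symm) (fun x hx h => clique 0 a' ha' x hx h.symm)
    (fun x hx h => clique 1 b hb x hx h.symm) (fun x hx h => clique 1 b' hb' x hx h.symm)
    (by rw [eA', eA, eB', eB]; exact hd) haa hbb hab hab'
    (by rw [eA', eA, card]; omega) (by rw [eB', eB, card]; omega)
    (Or.inl (by omega)) (Or.inr (clique 1 b hb b' hb' hbb))
  rwa [show k - 2 + (k - 3) + 4 = 2 * k - 1 by omega] at this

/-- Pairwise intersecting edges of a bipartite graph form a star. -/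
theorem exists_star_center {V : Type*} [Nonempty V] {r : V → V → Prop}
    (h : ∀ a a' b b', a ≠ a' → b ≠ b' → r a b → ¬ r a' b') :
    ∃ u, ∀ a b, r a b → a = u ∨ b = u := by
  by_cases h0 : ∃ a b, r a b
  · obtain ⟨a, b, hab⟩ := h0
    by_cases h1 : ∀ a' b', r a' b' → a' = a
    · exact ⟨a, fun a' b' h' => Or.inl (h1 a' b' h')⟩
    · push Not at h1
      obtain ⟨a', b', hab', hne⟩ := h1
      refine ⟨b, fun x y hxy => Or.inr ?_⟩
      have hb : b' = b := by
        by_contra hb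
        exact h a a' b b' hne.symm (Ne.symm hb) hab hab'
      subst hb
      by_contra hy
      have e1 : x = a := by
        by_contra hx
        exact h x a y b' hx hy hxy hab
      have e2 : x = a' := by
        by_contra hx
        exact h x a' y b' hx hy hxy hab'
      exact hne (e2.symm.trans e1)
  · push Not at h0
    exact ⟨Classical.arbitrary V, fun a b hab => absurd hab (h0 a b)⟩

/-- A two-coloured `K_6` in which a colour contains a five-cycle has a monochromatic
four-cycle. -/
theorem hasCycle_four_of_five [Fintype V] {R B : SimpleGraph V}
    (hc : ∀ x y, x ≠ y → R.Adj x y ∨ B.Adj x y) (hV : 6 ≤ Fintype.card V)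
    (h : HasCycle R 5) : HasCycle R 4 ∨ HasCycle B 4 := by
  obtain ⟨v, hv⟩ := h
  by_contra! hno
  have hu := hv.double (by decide) (hv.adj_add_two hc (by omega) hno.1)
  obtain ⟨x, -, hx⟩ := Finset.exists_mem_notMem_of_card_lt_card
    (s := (Finset.Icc 0 4).image v) (t := Finset.univ)
    (by rw [hv.card_image (by omega), Finset.card_univ]; omega)
  have hxv : ∀ i, x ≠ v i := by
    rintro i rfl
    apply hx
    have hper : Function.Periodic v 5 := hv.per
    rw [← hper.map_mod_nat i]
    exact Finset.mem_image_of_mem _ (by simp; omega)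
  -- The sixth vertex cannot see two vertices at distance 2 on a pentagon of the same colour.
  -- Applied to the pentagon and to its complementary pentagon, this leaves no colouring of the
  -- edges at `x`.
  have key : ∀ {G : SimpleGraph V} {w : ℕ → V}, IsCyc G 5 w → ¬ HasCycle G 4 →
      (∀ i, x ≠ w i) → ∀ i, G.Adj x (w i) → ¬ G.Adj x (w (i + 2)) := by
    intro G w hw hG hxw i h1 h2
    apply hG
    have hx' : x ∉ (Finset.Icc i (i + 2)).image w := by
      simp only [Finset.mem_image, not_exists, not_and]
      exact fun j _ h => hxw j h.symm
    have := ((hw.path (i := i) (j := i + 2) (by omega) (by omega)).snoc hx' h2.symm).hasCycle h1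
    rwa [Finset.card_insert_of_notMem hx', hw.card_image (by omega),
      show i + 2 + 1 - i + 1 = 4 by omega] at this
  have kR := key hv hno.1 hxv
  have kB := key hu hno.2 fun i => hxv _
  have e5 : v 5 = v 0 := hv.per 0
  have e6 : v 6 = v 1 := hv.per 1
  have e8 : v 8 = v 3 := hv.per 3
  have e10 : v 10 = v 0 := (hv.per 5).trans e5
  have e12 : v 12 = v 2 := (hv.per 7).trans (hv.per 2)
  rcases hc x (v 0) (hxv 0) with h0 | h0
  · have h2 := (hc x (v 2) (hxv 2)).resolve_left (kR 0 h0)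
    have h3 := (hc x (v 3) (hxv 3)).resolve_left fun h => kR 3 h (by rw [e5]; exact h0)
    exact kB 4 (by rw [e8]; exact h3) (by rw [e12]; exact h2)
  · have h1 := (hc x (v 1) (hxv 1)).resolve_right fun h =>
      kB 3 (by rw [e6]; exact h) (by rw [e10]; exact h0)
    have h3 := (hc x (v 3) (hxv 3)).resolve_left (kR 1 h1)
    have h4 := (hc x (v 4) (hxv 4)).resolve_left fun h => kR 4 h (by rw [e6]; exact h1)
    exact kB 2 h4 (by rw [e8]; exact h3)

end

/-! ### Vertices off a longest monochromatic cycle. -/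

section


variable {V : Type*} [DecidableEq V]

/-- On a cyclic order, the set where `P` holds and its shift have equal size, and they overlap in at
most `q` places. -/
theorem two_mul_card_filter_le {L q : ℕ} {P : ℕ → Prop} [DecidablePred P]
    (hP : P L ↔ P 0) (h : ((Finset.range L).filter fun i => P i ∧ P (i + 1)).card ≤ q) :
    2 * ((Finset.range L).filter P).card ≤ L + q := by
  have h1 : ((Finset.range L).filter fun i => P (i + 1)).card = ((Finset.range L).filter P).card := by
    simp only [Finset.card_filter]
    have e1 := Finset.sum_range_succ (fun i => if P i then 1 else 0) L
    have e2 := Finset.sum_range_succ' (fun i => if P i then 1 else 0) L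
    simp only [hP] at e1
    omega
  have h2 := Finset.card_union_add_card_inter ((Finset.range L).filter P)
    ((Finset.range L).filter fun i => P (i + 1))
  rw [← Finset.filter_and] at h2
  have h3 : ((Finset.range L).filter P ∪ (Finset.range L).filter fun i => P (i + 1)).card ≤ L := by
    rw [← Finset.filter_or]
    exact (Finset.card_filter_le _ _).trans (Finset.card_range L).le
  omega

namespace IsCyc

variable {G R B : SimpleGraph V} {L : ℕ} {v : ℕ → V}

/-- The path replaces the edge from `v i` to `v (i + 1)`. -/
theorem hasCycle_of_detour (hv : IsCyc G L v) (hL : 0 < L) {s : Finset V} {x y : V}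
    (hp : PathOn G s x y) (hs : ∀ z ∈ s, ∀ i, z ≠ v i) {i : ℕ} (hx : G.Adj x (v i))
    (hy : G.Adj y (v (i + 1))) : HasCycle G (L + s.card) := by
  have p := hv.path (i := i + 1) (j := i + L) (by omega) (by omega)
  have d : Disjoint ((Finset.Icc (i + 1) (i + L)).image v) s := by
    rw [Finset.disjoint_left]
    simp only [Finset.mem_image]
    rintro _ ⟨j, -, rfl⟩ h
    exact hs _ h j rfl
  have := (p.append hp d (by rw [hv.per]; exact hx.symm)).hasCycle hy
  rwa [Finset.card_union_of_disjoint d, hv.card_image (by omega),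
    show i + L + 1 - (i + 1) = L by omega] at this

/-- Two edges of the cycle are cut and one arc is reversed: `x` links the vertices before the cuts,
`y` those after them. -/
theorem hasCycle_of_double_detour (hv : IsCyc G L v) {x y : V} (hxy : x ≠ y)
    (hxv : ∀ i, x ≠ v i) (hyv : ∀ i, y ≠ v i) {i j : ℕ} (hij : i < j) (hj : j < i + L)
    (hxi : G.Adj x (v i)) (hxj : G.Adj x (v j)) (hyi : G.Adj y (v (i + 1)))
    (hyj : G.Adj y (v (j + 1))) : HasCycle G (L + 2) := by
  have p1 := hv.path (i := i + 1) (j := j) (by omega) (by omega)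
  have p2 := hv.path (i := j + 1) (j := i + L) (by omega) (by omega)
  have d := hv.disjoint_image (i := i + 1) (j := j) (i' := j + 1) (j' := i + L)
    (by omega) (by omega)
  have hx1 : x ∉ (Finset.Icc (j + 1) (i + L)).image v := by
    simp only [Finset.mem_image, not_exists, not_and]
    exact fun j _ h => hxv j h.symm
  have hy1 : y ∉ insert x ((Finset.Icc (j + 1) (i + L)).image v) ∪
      (Finset.Icc (i + 1) j).image v := by
    simp only [Finset.mem_union, Finset.mem_insert, Finset.mem_image, not_or, not_exists, not_and]
    exact ⟨⟨hxy.symm, fun j _ h => hyv j h.symm⟩, fun j _ h => hyv j h.symm⟩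
  have d' : Disjoint (insert x ((Finset.Icc (j + 1) (i + L)).image v))
      ((Finset.Icc (i + 1) j).image v) := by
    rw [Finset.disjoint_insert_left]
    refine ⟨?_, d.symm⟩
    simp only [Finset.mem_image, not_exists, not_and]
    exact fun j _ h => hxv j h.symm
  have := (((p2.snoc hx1 (by rw [hv.per]; exact hxi.symm)).append p1.symm d' hxj).snoc hy1
    hyi.symm).hasCycle hyj
  rwa [Finset.card_insert_of_notMem hy1, Finset.card_union_of_disjoint d',
    Finset.card_insert_of_notMem hx1, hv.card_image (by omega), hv.card_image (by omega),
    show i + L + 1 - (j + 1) + 1 + (j + 1 - (i + 1)) + 1 = L + 2 by omega] at this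

theorem card_image_range {G : SimpleGraph V} (hv : IsCyc G L v) {T : Finset ℕ}
    (hT : T ⊆ Finset.range L) : (T.image v).card = T.card := by
  apply Finset.card_image_of_injOn
  intro x hx y hy hxy
  have hx' := Finset.mem_range.1 (hT hx)
  have hy' := Finset.mem_range.1 (hT hy)
  by_contra hne
  rcases Nat.lt_or_gt_of_ne hne with h | h
  · exact hv.ne _ _ h (by omega) hxy
  · exact hv.ne _ _ h (by omega) hxy.symm

/-- Off a longest monochromatic cycle, any two vertices have many common neighbours on the cycle
in the other colour. -/
theorem rich (hv : IsCyc R L v) (hL : 0 < L) (hc : ∀ x y, x ≠ y → R.Adj x y ∨ B.Adj x y)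
    (hR : ∀ m, L < m → ¬ HasCycle R m) {W : Finset V} (hW : ∀ x ∈ W, ∀ i, x ≠ v i) :
    Rich B W ((Finset.range L).image v) ((L - 1) / 2) := by
  classical
  intro x hx y hy hxy F hF
  have same : ∀ z ∈ W, ∀ i, R.Adj z (v i) → ¬ R.Adj z (v (i + 1)) := by
    intro z hz i h1 h2
    refine hR _ ?_ (hv.hasCycle_of_detour hL (PathOn.single R z) ?_ h1 h2)
    · simp
    · simpa using hW z hz
  have one : ∀ x ∈ W, ∀ y ∈ W, x ≠ y →
      ((Finset.range L).filter fun i => R.Adj x (v i) ∧ R.Adj y (v (i + 1))).card ≤ 1 := by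
    intro x hx y hy hxy
    rw [Finset.card_le_one]
    have : ∀ i j, i < j → j < i + L → R.Adj x (v i) → R.Adj x (v j) → R.Adj y (v (i + 1)) →
        ¬ R.Adj y (v (j + 1)) := fun i j h1 h2 h3 h4 h5 h6 => hR _ (by omega)
      (hv.hasCycle_of_double_detour hxy (hW x hx) (hW y hy) h1 h2 h3 h4 h5 h6)
    intro i hi j hj
    simp only [Finset.mem_filter, Finset.mem_range] at hi hj
    by_contra hne
    rcases Nat.lt_or_gt_of_ne hne with h | h
    · exact this i j h (by omega) hi.2.1 hj.2.1 hi.2.2 hj.2.2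
    · exact this j i h (by omega) hj.2.1 hi.2.1 hj.2.2 hi.2.2
  have hL0 : v L = v 0 := by simpa using hv.per 0
  -- Consecutive `R`-neighbours must belong to different vertices of the pair, and each of the two
  -- orders occurs at most once; hence `q = 2`.
  have hM := two_mul_card_filter_le (L := L) (q := 2) (P := fun i => R.Adj x (v i) ∨ R.Adj y (v i))
    (by rw [hL0]) (by
      have hsub : ((Finset.range L).filter fun i => (R.Adj x (v i) ∨ R.Adj y (v i)) ∧
          (R.Adj x (v (i + 1)) ∨ R.Adj y (v (i + 1)))) ⊆
          ((Finset.range L).filter fun i => R.Adj x (v i) ∧ R.Adj y (v (i + 1))) ∪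
          ((Finset.range L).filter fun i => R.Adj y (v i) ∧ R.Adj x (v (i + 1))) := by
        intro i hi
        have s1 := same x hx i
        have s2 := same y hy i
        simp only [Finset.mem_filter, Finset.mem_union] at hi ⊢
        tauto
      have h1 := Finset.card_le_card hsub
      have h2 := Finset.card_union_le
        ((Finset.range L).filter fun i => R.Adj x (v i) ∧ R.Adj y (v (i + 1)))
        ((Finset.range L).filter fun i => R.Adj y (v i) ∧ R.Adj x (v (i + 1)))
      have h3 := one x hx y hy hxy
      have h4 := one y hy x hx hxy.symm
      omega)
  have hcard := Finset.card_filter_add_card_filter_not (s := Finset.range L)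
    (fun i => R.Adj x (v i) ∨ R.Adj y (v i))
  rw [Finset.card_range] at hcard
  have hI := hv.card_image_range (Finset.filter_subset (fun i => ¬ (R.Adj x (v i) ∨ R.Adj y (v i)))
    (Finset.range L))
  obtain ⟨z, hz, hzF⟩ := Finset.exists_mem_notMem_of_card_lt_card (s := F)
    (t := ((Finset.range L).filter fun i => ¬ (R.Adj x (v i) ∨ R.Adj y (v i))).image v) (by omega)
  simp only [Finset.mem_image, Finset.mem_filter, not_or] at hz
  obtain ⟨i, ⟨hi, hxi, hyi⟩, rfl⟩ := hz
  exact ⟨v i, Finset.mem_image_of_mem v hi, hzF, (hc _ _ (hW x hx i)).resolve_left hxi,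
    ((hc _ _ (hW y hy i)).resolve_left hyi).symm⟩

/-- Off a longest monochromatic cycle, a set connected in its colour is completely joined in the
other colour to half of the cycle. -/
theorem exists_complete_half (hv : IsCyc R L v) (hL : 0 < L)
    (hc : ∀ x y, x ≠ y → R.Adj x y ∨ B.Adj x y)
    (hR : ∀ m, L < m → ¬ HasCycle R m) {W Y : Finset V} (hW : ∀ x ∈ W, ∀ i, x ≠ v i)
    (hYW : Y ⊆ W) (hY : ∀ x ∈ Y, ∀ y ∈ Y, ∃ s ⊆ W, PathOn R s x y) :
    ∃ T ⊆ (Finset.range L).image v, L ≤ 2 * T.card ∧ ∀ x ∈ Y, ∀ y ∈ T, B.Adj x y := by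
  classical
  have hL0 : v L = v 0 := by simpa using hv.per 0
  have hM := two_mul_card_filter_le (L := L) (q := 0) (P := fun i => ∃ x ∈ Y, R.Adj x (v i))
    (by rw [hL0]) (by
      rw [Nat.le_zero, Finset.card_eq_zero, Finset.filter_eq_empty_iff]
      rintro i - ⟨⟨x, hx, hxi⟩, ⟨y, hy, hyi⟩⟩
      obtain ⟨s, hs, hp⟩ := hY x hx y hy
      have : 0 < s.card := Finset.card_pos.2 ⟨x, hp.left_mem⟩
      exact hR _ (by omega) (hv.hasCycle_of_detour hL hp (fun z hz => hW z (hs hz)) hxi hyi))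
  have hcard := Finset.card_filter_add_card_filter_not (s := Finset.range L)
    (fun i => ∃ x ∈ Y, R.Adj x (v i))
  rw [Finset.card_range] at hcard
  have hI := hv.card_image_range (Finset.filter_subset (fun i => ¬ ∃ x ∈ Y, R.Adj x (v i))
    (Finset.range L))
  refine ⟨_, Finset.image_subset_image (Finset.filter_subset (fun i => ¬ ∃ x ∈ Y, R.Adj x (v i))
    (Finset.range L)), by omega, ?_⟩
  intro x hx y hy
  simp only [Finset.mem_image, Finset.mem_filter] at hy
  obtain ⟨i, ⟨hi, hi'⟩, rfl⟩ := hy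
  exact (hc _ _ (hW x (hYW hx) i)).resolve_left fun h => hi' ⟨x, hx, h⟩

/-- Two disjoint edges from a cycle to a large clique off the cycle produce a longer cycle. -/
theorem exists_longer_of_clique (hv : IsCyc G L v) {W : Finset V} (hW : ∀ x ∈ W, ∀ i, x ≠ v i)
    (hclique : ∀ x ∈ W, ∀ y ∈ W, x ≠ y → G.Adj x y) (ht : L < 2 * W.card) {x y : V} (hx : x ∈ W)
    (hy : y ∈ W) (hxy : x ≠ y) {i j : ℕ} (hij : i < j) (hj : j < i + L) (hxi : G.Adj x (v i))
    (hyj : G.Adj y (v j)) : ∃ m, L < m ∧ HasCycle G m := by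
  have hWxy : insert x (insert y W) = W := by
    rw [Finset.insert_eq_of_mem hy, Finset.insert_eq_of_mem hx]
  have h2 : 2 ≤ W.card := Finset.one_lt_card.2 ⟨x, hx, y, hy, hxy⟩
  obtain ⟨s, hs, hp, hsc⟩ := exists_pathOn_through_clique (r := W.card - 2) hclique
    (fun z hz h => hclique x hx z hz h.symm) (fun z hz h => hclique y hy z hz h.symm) hxy
    (by rw [hWxy]; omega) (Or.inr (hclique x hx y hy hxy))
  rw [hWxy] at hs
  have d : ∀ I : Finset ℕ, Disjoint (I.image v) s := by
    intro I
    rw [Finset.disjoint_left]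
    simp only [Finset.mem_image]
    rintro _ ⟨j, -, rfl⟩ h
    exact hW _ (hs h) j rfl
  -- A Hamilton path of the clique closes either arc. The lengths of the two cycles add up to `L + 2
  -- + 2 * W.card`, which exceeds `2 * L`.
  have c1 := ((hv.path hij.le hj).append hp.symm (d _) hyj.symm).hasCycle hxi
  have c2 := ((hv.path (i := j) (j := i + L) (by omega) (by omega)).append hp (d _)
    (by rw [hv.per]; exact hxi.symm)).hasCycle hyj
  rw [Finset.card_union_of_disjoint (d _), hv.card_image (by omega), hsc] at c1 c2
  rcases Nat.lt_or_ge L (j + 1 - i + (W.card - 2 + 2)) with h | h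
  · exact ⟨_, h, c1⟩
  · exact ⟨_, by omega, c2⟩

end IsCyc

/-- A set is either connected within itself or splits into two nonempty parts without edges
between them. -/
theorem connected_or_split (R : SimpleGraph V) (W : Finset V) :
    (∀ x ∈ W, ∀ y ∈ W, ∃ s ⊆ W, PathOn R s x y) ∨
    ∃ X Y, X ∪ Y = W ∧ Disjoint X Y ∧ X.Nonempty ∧ Y.Nonempty ∧
      ∀ x ∈ X, ∀ y ∈ Y, ¬ R.Adj x y := by
  classical
  -- Only the edges inside `W` are kept, on the same vertex type, so that walks from `W` stay in
  -- `W`.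
  set R' : SimpleGraph V := SimpleGraph.fromRel fun a b => R.Adj a b ∧ a ∈ W ∧ b ∈ W with hR'
  have hadj : ∀ a b, R'.Adj a b ↔ R.Adj a b ∧ a ∈ W ∧ b ∈ W := by
    intro a b
    simp only [hR', SimpleGraph.fromRel_adj]
    constructor
    · rintro ⟨-, h | h⟩
      · exact h
      · exact ⟨h.1.symm, h.2.2, h.2.1⟩
    · exact fun h => ⟨h.1.ne, Or.inl h⟩
  by_cases h : ∀ x ∈ W, ∀ y ∈ W, R'.Reachable x y
  · left
    intro x hx y hy
    obtain ⟨p, hp⟩ := (h x hx y hy).exists_isPath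
    have hsub : ∀ z ∈ p.support, z ∈ W := by
      clear hp
      induction p with
      | nil => simpa using hx
      | cons e p ih =>
        intro z hz
        rw [SimpleGraph.Walk.support_cons, List.mem_cons] at hz
        rcases hz with rfl | hz
        · exact hx
        · exact ih ((hadj _ _).1 e).2.2 hy z hz
    refine ⟨p.support.toFinset, fun z hz => hsub z (by simpa using hz), p.support, hp.support_nodup,
      ?_, rfl, ?_, ?_⟩
    · exact p.isChain_adj_support.imp fun a b h => ((hadj a b).1 h).1
    · rw [List.head?_eq_some_head p.support_ne_nil, p.head_support]
    · rw [List.getLast?_eq_some_getLast p.support_ne_nil, p.getLast_support]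
  · right
    push Not at h
    obtain ⟨x, hx, y, hy, hxy⟩ := h
    refine ⟨W.filter fun z => R'.Reachable x z, W.filter fun z => ¬ R'.Reachable x z,
      Finset.filter_union_filter_not_eq _ _, Finset.disjoint_filter_filter_not _ _ _,
      ⟨x, by simp [hx]⟩, ⟨y, by simp [hy, hxy]⟩, ?_⟩
    intro a ha b hb hab
    simp only [Finset.mem_filter] at ha hb
    exact hb.2 (ha.2.trans ((hadj a b).2 ⟨hab, ha.1, hb.1⟩).reachable)

end

/-! ### A monochromatic cycle of length at least `n`. -/

section


variable {V : Type*} [DecidableEq V] {R B : SimpleGraph V} {L : ℕ} {v : ℕ → V}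

/-- If the rest of the vertices is connected in the colour of the cycle, the cycle is not a longest
monochromatic one. -/
theorem IsCyc.not_longest_of_connected (hv : IsCyc R L v) (hL : 3 ≤ L)
    (hc : ∀ x y, x ≠ y → R.Adj x y ∨ B.Adj x y)
    (hR : ∀ m, L < m → ¬ HasCycle R m) (hB : ∀ m, L < m → ¬ HasCycle B m) {W : Finset V}
    (hW : ∀ x ∈ W, ∀ i, x ≠ v i) (ht : L + 3 ≤ 2 * W.card)
    (hcon : ∀ x ∈ W, ∀ y ∈ W, ∃ s ⊆ W, PathOn R s x y) : False := by
  obtain ⟨T, hT, hTL, hWT⟩ := hv.exists_complete_half (by omega) hc hR hW subset_rfl hcon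
  have hWC : Disjoint W ((Finset.range L).image v) := by
    rw [Finset.disjoint_left]
    simp only [Finset.mem_image, not_exists, not_and]
    exact fun x hx i _ h => hW x hx i h.symm
  have hdT : Disjoint W T := Finset.disjoint_of_subset_right hT hWC
  -- If `T` exceeds half the cycle, the `B`-bipartite graph is already large enough. Afterwards `L =
  -- 2 * T.card`, so `L` is even.
  rcases Nat.lt_or_ge L (2 * T.card) with h | h
  · exact hB _ (by omega) (hasCycle_of_complete_bipartite (m := (L + 2) / 2) (by omega) (by omega)
      (by omega) hdT hWT)
  -- A `B`-edge inside `W` would close an odd `B`-cycle of length `L + 1`.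
  have hclique : ∀ x ∈ W, ∀ y ∈ W, x ≠ y → R.Adj x y := by
    intro x hx y hy hxy
    refine (hc x y hxy).resolve_right fun hb => ?_
    have hp := (PathOn.single B x).snoc (c := y) (by simpa using hxy.symm) hb
    have hs : ({y, x} : Finset V) ⊆ W := by simp [Finset.insert_subset_iff, hx, hy]
    have hcyc := (Rich.of_complete hWT).hasCycle_of_card (m := T.card - 1) hdT hp hx hy
      (by rw [Finset.card_sdiff_of_subset hs, Finset.card_pair hxy.symm]; omega) (Or.inl hxy)
      (by
        rw [Finset.disjoint_iff_inter_eq_empty.1 (Finset.disjoint_of_subset_left hs hdT),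
          Finset.card_empty]
        omega)
    rw [Finset.card_pair hxy.symm] at hcyc
    exact hB _ (by omega) hcyc
  have : Nonempty V := ⟨v 0⟩
  obtain ⟨u, hu⟩ := exists_star_center
    (r := fun x y => x ∈ W ∧ y ∈ (Finset.range L).image v ∧ R.Adj x y) (by
      rintro a a' b b' haa hbb ⟨ha, hb, hab⟩ ⟨ha', hb', hab'⟩
      simp only [Finset.mem_image, Finset.mem_range] at hb hb'
      obtain ⟨i, hi, rfl⟩ := hb
      obtain ⟨j, hj, rfl⟩ := hb'
      have hij : i ≠ j := fun h => hbb (by rw [h])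
      rcases Nat.lt_or_gt_of_ne hij with h | h
      · obtain ⟨m, hm, hcyc⟩ := hv.exists_longer_of_clique hW hclique (by omega) ha ha' haa h
          (by omega) hab hab'
        exact hR m hm hcyc
      · obtain ⟨m, hm, hcyc⟩ := hv.exists_longer_of_clique hW hclique (by omega) ha' ha haa.symm h
          (by omega) hab' hab
        exact hR m hm hcyc)
  have c1 := Finset.pred_card_le_card_erase (s := W) (a := u)
  have c2 := Finset.pred_card_le_card_erase (s := (Finset.range L).image v) (a := u)
  rw [hv.card_image_range subset_rfl, Finset.card_range] at c2
  -- All `R`-edges between `W` and the cycle meet `u`, so what remains is complete in `B` and holds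
  -- a cycle of length `L + 2`.
  refine hB _ ?_ (hasCycle_of_complete_bipartite (P := W.erase u)
    (Q := ((Finset.range L).image v).erase u) (m := L / 2 + 1) (by omega) (by omega) (by omega)
    (Finset.disjoint_of_subset_left (Finset.erase_subset _ _)
      (Finset.disjoint_of_subset_right (Finset.erase_subset _ _) hWC)) ?_)
  · omega
  · intro x hx y hy
    rw [Finset.mem_erase] at hx hy
    refine (hc x y ?_).resolve_left fun h => ?_
    · rintro rfl
      exact Finset.disjoint_left.1 hWC hx.2 hy.2
    · rcases hu x y ⟨hx.2, hy.2, h⟩ with h | h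
      · exact hx.1 h
      · exact hy.1 h

/-- A path in the other colour off a longest monochromatic cycle has few vertices. -/
theorem IsCyc.not_longest_of_path (hv : IsCyc R L v)
    (hc : ∀ x y, x ≠ y → R.Adj x y ∨ B.Adj x y)
    (hR : ∀ m, L < m → ¬ HasCycle R m) (hB : ∀ m, L < m → ¬ HasCycle B m) {W : Finset V}
    (hW : ∀ x ∈ W, ∀ i, x ≠ v i) (ht : L + 3 ≤ 2 * W.card) {s : Finset V} {a b : V}
    (hs : s ⊆ W) (hp : PathOn B s a b) (hab : a ≠ b)
    (hsL : Odd L ∧ 3 ≤ L ∧ s.card = 3 ∨ Even L ∧ 4 ≤ L ∧ s.card = 4) : False := by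
  have hWC : Disjoint W ((Finset.range L).image v) := by
    rw [Finset.disjoint_left]
    simp only [Finset.mem_image, not_exists, not_and]
    exact fun x hx i _ h => hW x hx i h.symm
  have hcard := Finset.card_sdiff_of_subset hs
  have hsC : (s ∩ (Finset.range L).image v).card = 0 := by
    rw [Finset.disjoint_iff_inter_eq_empty.1 (Finset.disjoint_of_subset_left hs hWC),
      Finset.card_empty]
  -- The parity of `s.card` matches that of `L`, so `m` bridged vertices and the closing bridge give
  -- length `L + 1`; the bridges use up the guaranteed `(L - 1) / 2` exactly.
  obtain ⟨m, hm, hm2, hm3⟩ : ∃ m, s.card + 2 * m = L ∧ m ≤ (W \ s).card ∧ m + 1 ≤ (L - 1) / 2 := by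
    rcases hsL with ⟨⟨k, hk⟩, h3, hs3⟩ | ⟨⟨k, hk⟩, h4, hs4⟩
    · exact ⟨k - 1, by omega, by omega, by omega⟩
    · exact ⟨k - 2, by omega, by omega, by omega⟩
  have hL : 0 < L := by
    have := Finset.card_pos.2 ⟨a, hp.left_mem⟩
    omega
  exact hB _ (by omega) ((hv.rich hL hc hR hW).hasCycle_of_card hWC hp (hs hp.left_mem)
    (hs hp.right_mem) hm2 (Or.inl hab) (by omega))

theorem exists_pathOn_three {a b c : V} (hab : B.Adj a b) (hbc : B.Adj b c) (hac : a ≠ c) :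
    PathOn B {c, b, a} a c ∧ ({c, b, a} : Finset V).card = 3 :=
  ⟨((PathOn.single B a).snoc (by simpa using hab.ne.symm) hab).snoc
    (by simp [hbc.ne.symm, hac.symm]) hbc,
    Finset.card_eq_three.2 ⟨c, b, a, hbc.ne.symm, hac.symm, hab.ne.symm, rfl⟩⟩

theorem exists_pathOn_four {a b c d : V} (hab : B.Adj a b) (hbc : B.Adj b c) (hcd : B.Adj c d)
    (hac : a ≠ c) (had : a ≠ d) (hbd : b ≠ d) :
    PathOn B {d, c, b, a} a d ∧ ({d, c, b, a} : Finset V).card = 4 := by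
  have h := exists_pathOn_three hab hbc hac
  have hd : d ∉ ({c, b, a} : Finset V) := by simp [hcd.ne.symm, hbd.symm, had.symm]
  exact ⟨h.1.snoc hd hcd, by rw [Finset.card_insert_of_notMem hd, h.2]⟩

/-- If one vertex is joined to all other vertices off the cycle in the other colour, the cycle is
not a longest monochromatic one. -/
theorem IsCyc.not_longest_of_apex (hv : IsCyc R L v) (hL : 4 ≤ L) (hev : Even L)
    (hc : ∀ x y, x ≠ y → R.Adj x y ∨ B.Adj x y)
    (hR : ∀ m, L < m → ¬ HasCycle R m) (hB : ∀ m, L < m → ¬ HasCycle B m) {W : Finset V}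
    (hW : ∀ x ∈ W, ∀ i, x ≠ v i) (ht : L + 3 ≤ 2 * W.card) {x : V} {Y : Finset V}
    (hxY : x ∉ Y) (hWY : insert x Y = W) (hx : ∀ y ∈ Y, B.Adj x y) : False := by
  have hYW : Y ⊆ W := hWY ▸ Finset.subset_insert x Y
  have hxW : x ∈ W := hWY ▸ Finset.mem_insert_self x Y
  have hcard : W.card = Y.card + 1 := by rw [← hWY, Finset.card_insert_of_notMem hxY]
  obtain ⟨k, hk⟩ := hev
  by_cases hY : ∀ y ∈ Y, ∀ z ∈ Y, y ≠ z → R.Adj y z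
  -- With `Y` an `R`-clique, half of the cycle is `B`-joined to `Y`; adding `x` to that half
  -- supplies the one missing vertex.
  · obtain ⟨T, hT, hTL, hYT⟩ := hv.exists_complete_half (by omega) hc hR hW hYW (by
      intro y hy z hz
      rcases eq_or_ne y z with rfl | hyz
      · exact ⟨{y}, by simpa using hYW hy, PathOn.single R y⟩
      · exact ⟨{z, y}, by simp [Finset.insert_subset_iff, hYW hy, hYW hz],
          (PathOn.single R y).snoc (by simpa using hyz.symm) (hY y hy z hz hyz)⟩)
    have hnot : ∀ z ∈ W, z ∉ T := by
      intro z hz hzT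
      obtain ⟨i, -, h⟩ := Finset.mem_image.1 (hT hzT)
      exact hW z hz i h.symm
    refine hB _ ?_ (hasCycle_of_complete_bipartite (P := Y) (Q := insert x T) (m := k + 1)
      (by omega) (by omega) (by rw [Finset.card_insert_of_notMem (hnot x hxW)]; omega) ?_ ?_)
    · omega
    · rw [Finset.disjoint_insert_right, Finset.disjoint_left]
      exact ⟨hxY, fun z hz => hnot z (hYW hz)⟩
    · intro y hy z hz
      rcases Finset.mem_insert.1 hz with rfl | hz
      · exact (hx y hy).symm
      · exact hYT y hy z hz
  · push Not at hY
    obtain ⟨y, hy, z, hz, hyz, hnR⟩ := hY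
    have hb := (hc y z hyz).resolve_left hnR
    obtain ⟨z', hz', hnot⟩ := Finset.exists_mem_notMem_of_card_lt_card (s := {y, z}) (t := Y)
      (by rw [Finset.card_pair hyz]; omega)
    simp only [Finset.mem_insert, Finset.mem_singleton, not_or] at hnot
    obtain ⟨hp, h4⟩ := exists_pathOn_four hb.symm (hx y hy).symm (hx z' hz')
      (by rintro rfl; exact hxY hz) (Ne.symm hnot.2) (Ne.symm hnot.1)
    exact hv.not_longest_of_path hc hR hB hW ht
      (by simp [Finset.insert_subset_iff, hYW hy, hYW hz, hYW hz', hxW]) hp (Ne.symm hnot.2)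
      (Or.inr ⟨⟨k, hk⟩, hL, h4⟩)

/-- If the complement of the cycle is not `R`-connected, it contains a complete bipartite `B`-graph,
hence a `B`-path on three vertices for odd `L`. Even `L` needs four, which a part of size one may
fail to provide; that is the apex case. -/
theorem IsCyc.not_longest [Fintype V] (hv : IsCyc R L v) (hL : 3 ≤ L)
    (hc : ∀ x y, x ≠ y → R.Adj x y ∨ B.Adj x y) (hV : 3 * (L + 1) ≤ 2 * Fintype.card V)
    (hR : ∀ m, L < m → ¬ HasCycle R m) (hB : ∀ m, L < m → ¬ HasCycle B m) : False := by
  obtain ⟨W, hWdef⟩ : ∃ W, W = Finset.univ \ (Finset.range L).image v := ⟨_, rfl⟩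
  have hW : ∀ x ∈ W, ∀ i, x ≠ v i := by
    rintro x hx i rfl
    rw [hWdef, Finset.mem_sdiff] at hx
    apply hx.2
    have hper : Function.Periodic v L := hv.per
    rw [← hper.map_mod_nat i]
    exact Finset.mem_image_of_mem _ (Finset.mem_range.2 (Nat.mod_lt _ (by omega)))
  have ht : L + 3 ≤ 2 * W.card := by
    rw [hWdef, Finset.card_sdiff_of_subset (Finset.subset_univ _),
      hv.card_image_range subset_rfl, Finset.card_range, Finset.card_univ]
    omega
  rcases connected_or_split R W with hcon | ⟨X, Y, hXY, hd, ⟨x, hx⟩, ⟨y, hy⟩, hno⟩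
  · exact hv.not_longest_of_connected hL hc hR hB hW ht hcon
  have hXW : X ⊆ W := hXY ▸ Finset.subset_union_left
  have hYW : Y ⊆ W := hXY ▸ Finset.subset_union_right
  have hb : ∀ x ∈ X, ∀ y ∈ Y, B.Adj x y := by
    intro x hx y hy
    refine (hc x y ?_).resolve_left (hno x hx y hy)
    rintro rfl
    exact Finset.disjoint_left.1 hd hx hy
  have hcard : W.card = X.card + Y.card := by rw [← hXY, Finset.card_union_of_disjoint hd]
  have other : ∀ {Z : Finset V} {z : V}, z ∈ Z → 2 ≤ Z.card → ∃ z' ∈ Z, z ≠ z' := by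
    intro Z z hz h
    obtain ⟨z', hz', hne⟩ := Finset.exists_mem_ne h z
    exact ⟨z', hz', hne.symm⟩
  rcases Nat.even_or_odd L with hev | hodd
  · have hL4 : 4 ≤ L := by
      obtain ⟨k, hk⟩ := hev
      omega
    rcases Nat.lt_or_ge X.card 2 with hX | hX
    · have hX1 : X = {x} := by
        obtain ⟨z, hz⟩ := Finset.card_eq_one.1 (show X.card = 1 by
          have := Finset.card_pos.2 ⟨x, hx⟩
          omega)
        rw [hz, Finset.mem_singleton] at hx
        rw [hz, hx]
      refine hv.not_longest_of_apex hL4 hev hc hR hB hW ht (x := x) (Y := Y)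
        (Finset.disjoint_left.1 hd hx) ?_ (hb x hx)
      rw [← hXY, hX1, Finset.insert_eq]
    rcases Nat.lt_or_ge Y.card 2 with hY | hY
    · have hY1 : Y = {y} := by
        obtain ⟨z, hz⟩ := Finset.card_eq_one.1 (show Y.card = 1 by
          have := Finset.card_pos.2 ⟨y, hy⟩
          omega)
        rw [hz, Finset.mem_singleton] at hy
        rw [hz, hy]
      refine hv.not_longest_of_apex hL4 hev hc hR hB hW ht (x := y) (Y := X)
        (Finset.disjoint_right.1 hd hy) ?_ (fun z hz => (hb z hz y hy).symm)
      rw [← hXY, hY1, Finset.insert_eq, Finset.union_comm]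
    obtain ⟨x', hx', hxx⟩ := other hx hX
    obtain ⟨y', hy', hyy⟩ := other hy hY
    have hxy' := (hb x hx y' hy').ne
    obtain ⟨hp, h4⟩ := exists_pathOn_four (hb x hx y hy) (hb x' hx' y hy).symm (hb x' hx' y' hy')
      hxx hxy' hyy
    exact hv.not_longest_of_path hc hR hB hW ht
      (by simp [Finset.insert_subset_iff, hXW hx, hXW hx', hYW hy, hYW hy']) hp hxy'
      (Or.inr ⟨hev, hL4, h4⟩)
  · rcases Nat.lt_or_ge X.card 2 with hX | hX
    · obtain ⟨y', hy', hyy⟩ := other hy (by omega)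
      obtain ⟨hp, h3⟩ := exists_pathOn_three (hb x hx y hy).symm (hb x hx y' hy') hyy
      exact hv.not_longest_of_path hc hR hB hW ht
        (by simp [Finset.insert_subset_iff, hXW hx, hYW hy, hYW hy']) hp hyy
        (Or.inl ⟨hodd, hL, h3⟩)
    · obtain ⟨x', hx', hxx⟩ := other hx hX
      obtain ⟨hp, h3⟩ := exists_pathOn_three (hb x hx y hy) (hb x' hx' y hy).symm hxx
      exact hv.not_longest_of_path hc hR hB hW ht
        (by simp [Finset.insert_subset_iff, hXW hx, hXW hx', hYW hy]) hp hxx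
        (Or.inl ⟨hodd, hL, h3⟩)

theorem hasCycle_three [Fintype V] (hc : ∀ x y, x ≠ y → R.Adj x y ∨ B.Adj x y)
    (hV : 6 ≤ Fintype.card V) : HasCycle R 3 ∨ HasCycle B 3 := by
  classical
  have tri : ∀ {G : SimpleGraph V} {a b c : V}, G.Adj a b → G.Adj b c → G.Adj c a →
      HasCycle G 3 := by
    intro G a b c hab hbc hca
    obtain ⟨hp, h3⟩ := exists_pathOn_three hab hbc hca.ne.symm
    exact h3 ▸ hp.hasCycle hca
  have key : ∀ {G H : SimpleGraph V}, (∀ x y, x ≠ y → G.Adj x y ∨ H.Adj x y) → ∀ {x : V}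
      {S : Finset V}, 3 ≤ S.card → (∀ y ∈ S, G.Adj x y) → HasCycle G 3 ∨ HasCycle H 3 := by
    intro G H hc x S hS hx
    by_cases h : ∃ a ∈ S, ∃ b ∈ S, G.Adj a b
    · obtain ⟨a, ha, b, hb, hab⟩ := h
      exact Or.inl (tri (hx a ha) hab (hx b hb).symm)
    · push Not at h
      exact Or.inr (hasCycle_of_clique (by omega) hS fun a ha b hb hab =>
        (hc a b hab).resolve_left (h a ha b hb))
  have : Nonempty V := Fintype.card_pos_iff.1 (by omega)
  obtain ⟨x⟩ := this
  have hcard := Finset.card_filter_add_card_filter_not (s := Finset.univ.erase x) (R.Adj x)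
  rw [Finset.card_erase_of_mem (Finset.mem_univ x), Finset.card_univ] at hcard
  rcases Nat.lt_or_ge ((Finset.univ.erase x).filter (R.Adj x)).card 3 with h | h
  · refine (key (fun x y h => (hc x y h).symm) (x := x)
      (S := (Finset.univ.erase x).filter fun y => ¬ R.Adj x y) (by omega) ?_).symm
    intro y hy
    simp only [Finset.mem_filter, Finset.mem_erase] at hy
    exact (hc x y (Ne.symm hy.1.1)).resolve_left hy.2
  · refine key hc (x := x) h ?_
    intro y hy
    exact (Finset.mem_filter.1 hy).2

/-- A two-coloured complete graph on at least `3n/2` vertices has a monochromatic cycle of length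
at least `n`. -/
theorem exists_long_cycle [Fintype V] (hc : ∀ x y, x ≠ y → R.Adj x y ∨ B.Adj x y) {n : ℕ}
    (hn : 4 ≤ n) (hV : 3 * n ≤ 2 * Fintype.card V) : ∃ L, n ≤ L ∧ (HasCycle R L ∨ HasCycle B L) := by
  classical
  have h3 := hasCycle_three hc (by omega)
  by_contra! hno
  have hb : ∀ m, HasCycle R m ∨ HasCycle B m → m < n := by
    intro m hm
    by_contra hmn
    rcases hm with hm | hm
    · exact (hno m (by omega)).1 hm
    · exact (hno m (by omega)).2 hm
  have h1 := Nat.findGreatest_spec (P := fun m => HasCycle R m ∨ HasCycle B m) (n := n) (m := 3)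
    (by omega) h3
  have h2 := Nat.le_findGreatest (P := fun m => HasCycle R m ∨ HasCycle B m) (n := n) (m := 3)
    (by omega) h3
  have hmax : ∀ m, Nat.findGreatest (fun m => HasCycle R m ∨ HasCycle B m) n < m →
      ¬ (HasCycle R m ∨ HasCycle B m) := fun m hm h =>
    Nat.findGreatest_is_greatest hm (hb m h).le h
  have hlt := hb _ h1
  rcases h1 with ⟨v, hv⟩ | ⟨v, hv⟩
  · exact hv.not_longest h2 hc (by omega) (fun m hm h => hmax m hm (Or.inl h))
      (fun m hm h => hmax m hm (Or.inr h))
  · exact hv.not_longest h2 (fun x y h => (hc x y h).symm) (by omega)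
      (fun m hm h => hmax m hm (Or.inr h)) (fun m hm h => hmax m hm (Or.inl h))

end

/-! ### Odd cycles of length `2h + 1` in nearly bipartite or nearly complete graphs. -/

section


variable {V : Type*} [DecidableEq V] {G H R B : SimpleGraph V} {h n : ℕ}

/-- An edge inside one class of a complete bipartite graph closes an odd cycle. -/
theorem hasCycle_odd_of_complete_bipartite {P Q : Finset V} (hP : h + 1 ≤ P.card)
    (hQ : h ≤ Q.card) (h1 : 1 ≤ h) (hPQ : Disjoint P Q) (hcomp : ∀ x ∈ P, ∀ y ∈ Q, H.Adj x y)
    {x y : V} (hx : x ∈ P) (hy : y ∈ P) (hxy : H.Adj x y) : HasCycle H (2 * h + 1) := by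
  have hp := (PathOn.single H x).snoc (c := y) (by simpa using hxy.ne.symm) hxy
  have hs : ({y, x} : Finset V) ⊆ P := by simp [Finset.insert_subset_iff, hx, hy]
  have hcyc := (Rich.of_complete hcomp).hasCycle_of_card (m := h - 1) hPQ hp hx hy
    (by rw [Finset.card_sdiff_of_subset hs, Finset.card_pair hxy.ne.symm]; omega)
    (Or.inl hxy.ne)
    (by
      rw [Finset.disjoint_iff_inter_eq_empty.1 (Finset.disjoint_of_subset_left hs hPQ),
        Finset.card_empty]
      omega)
  rwa [Finset.card_pair hxy.ne.symm, show 2 + 2 * (h - 1) + 1 = 2 * h + 1 by omega] at hcyc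

/-- A vertex joined to both classes of a complete bipartite graph closes an odd cycle. -/
theorem hasCycle_odd_of_apex {P Q : Finset V} (hP : h ≤ P.card) (hQ : h ≤ Q.card) (h2 : 2 ≤ h)
    (hPQ : Disjoint P Q) (hcomp : ∀ x ∈ P, ∀ y ∈ Q, H.Adj x y) {w a b : V} (hwP : w ∉ P)
    (hwQ : w ∉ Q) (ha : a ∈ P) (hb : b ∈ Q) (hwa : H.Adj w a) (hwb : H.Adj w b) :
    HasCycle H (2 * h + 1) := by
  obtain ⟨a', ha', hne⟩ := Finset.exists_mem_ne (show 1 < P.card by omega) a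
  have hbP : b ∉ P := Finset.disjoint_right.1 hPQ hb
  have haQ : a ∉ Q := Finset.disjoint_left.1 hPQ ha
  have haQ' : a' ∉ Q := Finset.disjoint_left.1 hPQ ha'
  obtain ⟨hp, h4⟩ := exists_pathOn_four hwa.symm hwb (hcomp a' ha' b hb).symm
    (by rintro rfl; exact hbP ha) hne.symm (by rintro rfl; exact hwP ha')
  have e1 : P \ {a', b, w, a} = P \ {a', a} := by
    ext z
    simp only [Finset.mem_sdiff, Finset.mem_insert, Finset.mem_singleton, not_or]
    constructor
    · tauto
    · rintro ⟨hz, h1, h2⟩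
      exact ⟨hz, h1, by rintro rfl; exact hbP hz, by rintro rfl; exact hwP hz, h2⟩
  have e2 : ({a', b, w, a} : Finset V) ∩ Q = {b} := by
    ext z
    simp only [Finset.mem_inter, Finset.mem_insert, Finset.mem_singleton]
    constructor
    · rintro ⟨rfl | rfl | rfl | rfl, hz⟩ <;> tauto
    · rintro rfl
      exact ⟨by tauto, hb⟩
  have hs : ({a', a} : Finset V) ⊆ P := by simp [Finset.insert_subset_iff, ha, ha']
  have hcyc := (Rich.of_complete hcomp).hasCycle_of_card (m := h - 2) hPQ hp ha ha'
    (by rw [e1, Finset.card_sdiff_of_subset hs, Finset.card_pair hne]; omega)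
    (Or.inl hne.symm)
    (by rw [e2, Finset.card_singleton]; omega)
  rwa [h4, show 4 + 2 * (h - 2) + 1 = 2 * h + 1 by omega] at hcyc

/-- A set completely joined to a clique that makes up more than half of an odd cycle. -/
theorem hasCycle_odd_of_joined_clique {C D : Finset V} (hC : ∀ x ∈ C, ∀ y ∈ C, x ≠ y → G.Adj x y)
    (hDC : ∀ x ∈ D, ∀ y ∈ C, G.Adj x y) (hd : Disjoint D C) (h1 : 1 ≤ h) (hh : h + 1 ≤ C.card)
    (hcard : 2 * h + 1 ≤ C.card + D.card) : HasCycle G (2 * h + 1) := by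
  rcases Finset.eq_empty_or_nonempty D with rfl | ⟨d, hdD⟩
  · exact hasCycle_of_clique (by omega) (by simpa using hcard) hC
  have hD := Finset.card_pos.2 ⟨d, hdD⟩
  -- With `k = min |D| h`, the cycle takes `k` vertices of `D` with `k - 1` bridges between them,
  -- and `2h + 2 - 2k` further vertices of the clique in one run.
  obtain ⟨k, hk1, hkD, hkh, hkC⟩ :
      ∃ k, 1 ≤ k ∧ k ≤ D.card ∧ k ≤ h ∧ 2 * h + 1 ≤ C.card + k := by
    rcases Nat.le_total D.card h with hle | hle
    · exact ⟨D.card, hD, le_rfl, hle, hcard⟩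
    · exact ⟨h, h1, hle, le_rfl, by omega⟩
  obtain ⟨K, hK, hKc⟩ := Finset.exists_subset_card_eq (s := D.erase d) (n := k - 1)
    (by rw [Finset.card_erase_of_mem hdD]; omega)
  have hKD := hK.trans (Finset.erase_subset d D)
  have hdC := Finset.disjoint_left.1 hd hdD
  have e : (({d} : Finset V) ∩ C).card = 0 := by
    rw [Finset.singleton_inter_of_notMem hdC, Finset.card_empty]
  obtain ⟨s, b, hp, hbD, -, -, hs, hsC, -⟩ := (Rich.of_complete hDC).extend hd K
    (PathOn.single G d) hdD hKD
    (by rw [Finset.disjoint_singleton_right]; exact fun h => Finset.notMem_erase d D (hK h))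
    (by omega)
  have hrest := Finset.card_sdiff_add_card_inter C s
  rw [Finset.inter_comm] at hrest
  obtain ⟨Q, hQ, hQc⟩ := Finset.exists_subset_card_eq (s := C \ s) (n := 2 * h + 2 - 2 * k)
    (by omega)
  have hQ' := Finset.subset_sdiff.1 hQ
  obtain ⟨x, hx, y, hy, hpQ⟩ := exists_pathOn_of_clique (G := G) (s := Q)
    (Finset.card_pos.1 (by omega)) fun x hx y hy => hC x (hQ'.1 hx) y (hQ'.1 hy)
  have := (hp.append hpQ hQ'.2.symm (hDC b hbD x (hQ'.1 hx))).hasCycle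
    (hDC d hdD y (hQ'.1 hy)).symm
  rwa [Finset.card_union_of_disjoint hQ'.2.symm, hs, hQc, Finset.card_singleton, hKc,
    show 1 + 2 * (k - 1) + (2 * h + 2 - 2 * k) = 2 * h + 1 by omega] at this

/-! ### The splitting of the vertex set for `n = 2h + 1`. -/

/-- After removal of a vertex, `G` contains two cliques covering all vertices and `H` contains
everything between them. -/
def Splits (G H : SimpleGraph V) : Prop :=
  ∃ (u : V) (X Y : Finset V), (∀ z, z ∈ X ∨ z ∈ Y ∨ z = u) ∧ Disjoint X Y ∧ u ∉ X ∧ u ∉ Y ∧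
    (∀ x ∈ X, ∀ y ∈ X, x ≠ y → G.Adj x y) ∧ (∀ x ∈ Y, ∀ y ∈ Y, x ≠ y → G.Adj x y) ∧
    ∀ x ∈ X, ∀ y ∈ Y, H.Adj x y

/-- Two disjoint `G`-edges across two sets, each joined to its own clique, give a monochromatic
odd cycle. -/
theorem not_two_cross (hc : ∀ x y, x ≠ y → G.Adj x y ∨ H.Adj x y) (h2 : 2 ≤ h)
    (hG : ¬ HasCycle G (2 * h + 1)) (hH : ¬ HasCycle H (2 * h + 1)) {A C X Y : Finset V}
    (hAX : A ⊆ X) (hCY : C ⊆ Y) (hXY : Disjoint X Y) (hA : h ≤ A.card) (hC : h + 1 ≤ C.card)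
    (hXA : ∀ x ∈ X, ∀ a ∈ A, a ≠ x → G.Adj x a) (hYC : ∀ y ∈ Y, ∀ c ∈ C, c ≠ y → G.Adj y c)
    (hcross : ∀ a ∈ A, ∀ c ∈ C, H.Adj a c) {a a' b b' : V} (ha : a ∈ X) (ha' : a' ∈ X)
    (hb : b ∈ Y) (hb' : b' ∈ Y) (haa : a ≠ a') (hbb : b ≠ b') (hab : G.Adj a b)
    (hab' : G.Adj a' b') : False := by
  have cliqueA : ∀ x ∈ A, ∀ y ∈ A, x ≠ y → G.Adj x y := fun x hx y hy hxy =>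
    hXA x (hAX hx) y hy hxy.symm
  have cliqueC : ∀ x ∈ C, ∀ y ∈ C, x ≠ y → G.Adj x y := fun x hx y hy hxy =>
    hYC x (hCY hx) y hy hxy.symm
  have subX : ∀ {x x'}, x ∈ X → x' ∈ X → insert x (insert x' A) ⊆ X := fun hx hx' => by
    simp [Finset.insert_subset_iff, hx, hx', hAX]
  have subY : ∀ {y y'}, y ∈ Y → y' ∈ Y → insert y (insert y' C) ⊆ Y := fun hy hy' => by
    simp [Finset.insert_subset_iff, hy, hy', hCY]
  have leA : ∀ x x', A.card ≤ (insert x (insert x' A)).card := fun x x' =>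
    Finset.card_le_card fun z hz => by simp [hz]
  have leC : ∀ x x', C.card ≤ (insert x (insert x' C)).card := fun x x' =>
    Finset.card_le_card fun z hz => by simp [hz]
  have cyc : ∀ {a a' b b'}, a ∈ X → a' ∈ X → b ∈ Y → b' ∈ Y → a ≠ a' → b ≠ b' → G.Adj a b →
      G.Adj a' b' → ∀ p q, p + q + 4 = 2 * h + 1 → p + 2 ≤ (insert a (insert a' A)).card →
      q + 2 ≤ (insert b (insert b' C)).card → (0 < p ∨ G.Adj a a') → (0 < q ∨ G.Adj b b') →
      False := by
    intro a a' b b' ha ha' hb hb' haa hbb hab hab' p q hpq hp hq hp0 hq0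
    apply hG
    rw [← hpq]
    exact hasCycle_of_two_cross cliqueA cliqueC (hXA a ha) (hXA a' ha') (hYC b hb) (hYC b' hb')
      (Finset.disjoint_of_subset_left (subX ha ha')
        (Finset.disjoint_of_subset_right (subY hb hb') hXY)) haa hbb hab hab' hp hq hp0 hq0
  have lA := leA a a'
  -- Here `h` vertices on the side of `A` and `h + 1` on the side of `C` suffice; for `h = 2` the
  -- first path has no inner vertex and is the edge itself.
  by_cases haG : G.Adj a a'
  · have lC := leC b b'
    exact cyc ha ha' hb hb' haa hbb hab hab' (h - 2) (h - 1) (by omega) (by omega) (by omega)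
      (Or.inr haG) (Or.inl (by omega))
  have haA : a ∉ A := fun h => haG (hXA a' ha' a h haa).symm
  have haA' : a' ∉ A := fun h => haG (hXA a ha a' h haa.symm)
  have hcard : (insert a (insert a' A)).card = A.card + 2 := by
    rw [Finset.card_insert_of_notMem (by simp [haa, haA]), Finset.card_insert_of_notMem haA']
  -- Now `a` and `a'` lie outside `A`, so the sizes can be exchanged. The ends in `Y` are kept
  -- general, to be replaced by vertices of `C` below.
  have noAdj : ∀ {b b'}, b ∈ Y → b' ∈ Y → b ≠ b' → G.Adj a b → G.Adj a' b' → ¬ G.Adj b b' := by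
    intro b b' hb hb' hbb hab hab' hbG
    have lC := leC b b'
    exact cyc ha ha' hb hb' haa hbb hab hab' (h - 1) (h - 2) (by omega) (by omega) (by omega)
      (Or.inl (by omega)) (Or.inr hbG)
  have hbG := noAdj hb hb' hbb hab hab'
  have hbC : b ∉ C := fun h => hbG (hYC b' hb' b h hbb).symm
  have hbC' : b' ∉ C := fun h => hbG (hYC b hb b' h hbb.symm)
  have hXYne : ∀ x ∈ X, ∀ y ∈ Y, x ≠ y := by
    rintro x hx y hy rfl
    exact Finset.disjoint_left.1 hXY hx hy
  have Ha : ∀ c ∈ C, H.Adj a c := fun c hcC =>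
    (hc a c (hXYne a ha c (hCY hcC))).resolve_left fun hac => by
      have hne : c ≠ b' := fun h => hbC' (h ▸ hcC)
      exact noAdj (hCY hcC) hb' hne hac hab' (hYC b' hb' c hcC hne).symm
  have Ha' : ∀ c ∈ C, H.Adj a' c := fun c hcC =>
    (hc a' c (hXYne a' ha' c (hCY hcC))).resolve_left fun hac => by
      have hne : c ≠ b := fun h => hbC (h ▸ hcC)
      exact noAdj hb (hCY hcC) hne.symm hab hac (hYC b hb c hcC hne)
  -- Everything from `a` and `a'` to `C` is in `H`, so the `H`-edge between them lies inside a class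
  -- of a complete bipartite graph.
  apply hH
  refine hasCycle_odd_of_complete_bipartite (P := insert a (insert a' A)) (Q := C) (x := a) (y := a')
    (by omega) (by omega) (by omega) ?_ ?_ (by simp) (by simp) ((hc a a' haa).resolve_left haG)
  · exact Finset.disjoint_of_subset_left (subX ha ha') (Finset.disjoint_of_subset_right hCY hXY)
  · intro x hx c hcC
    simp only [Finset.mem_insert] at hx
    rcases hx with rfl | rfl | hx
    · exact Ha c hcC
    · exact Ha' c hcC
    · exact hcross x hx c hcC

/-- A vertex with `H`-edges to both cliques would close an odd `H`-cycle, so each vertex is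
`G`-joined to all of `A` or all of `C`. The `G`-edges across this division form a star by
`not_two_cross`. Once its centre is removed, an `H`-edge inside a side would again give an odd
cycle. -/
theorem splits_of_cliques [Fintype V] (hc : ∀ x y, x ≠ y → G.Adj x y ∨ H.Adj x y) (h2 : 2 ≤ h)
    (hV : 3 * h + 2 ≤ Fintype.card V) (hG : ¬ HasCycle G (2 * h + 1))
    (hH : ¬ HasCycle H (2 * h + 1)) {A C : Finset V} (hAC : Disjoint A C) (hA : h ≤ A.card)
    (hC : h + 1 ≤ C.card) (cliqueA : ∀ x ∈ A, ∀ y ∈ A, x ≠ y → G.Adj x y)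
    (cliqueC : ∀ x ∈ C, ∀ y ∈ C, x ≠ y → G.Adj x y) (hcross : ∀ a ∈ A, ∀ c ∈ C, H.Adj a c) :
    Splits G H := by
  classical
  obtain ⟨X, hX⟩ : ∃ X : Finset V, ∀ w, w ∈ X ↔ w ∉ C ∧ ∀ a ∈ A, a ≠ w → G.Adj w a :=
    ⟨Finset.univ.filter fun w => w ∉ C ∧ ∀ a ∈ A, a ≠ w → G.Adj w a, by simp⟩
  have hAX : A ⊆ X := fun a ha => (hX a).2
    ⟨Finset.disjoint_left.1 hAC ha, fun a' ha' hne => cliqueA a ha a' ha' hne.symm⟩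
  have hCY : C ⊆ Xᶜ := fun c hcC => by
    rw [Finset.mem_compl, hX]
    exact fun h => h.1 hcC
  have hXY : Disjoint X Xᶜ := disjoint_compl_right
  have hXA : ∀ x ∈ X, ∀ a ∈ A, a ≠ x → G.Adj x a := fun x hx => ((hX x).1 hx).2
  have hYC : ∀ y ∈ Xᶜ, ∀ c ∈ C, c ≠ y → G.Adj y c := by
    intro y hy c hcC hne
    by_cases hyC : y ∈ C
    · exact cliqueC y hyC c hcC hne.symm
    have hyA : y ∉ A := fun h => Finset.mem_compl.1 hy (hAX h)
    refine (hc y c hne.symm).resolve_right fun hyc => ?_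
    rw [Finset.mem_compl, hX] at hy
    push Not at hy
    obtain ⟨a, ha, hay, hya⟩ := hy hyC
    exact hH (hasCycle_odd_of_apex hA (by omega) h2 hAC hcross hyA hyC ha hcC
      ((hc y a hay.symm).resolve_left hya) hyc)
  have : Nonempty V := Fintype.card_pos_iff.1 (by omega)
  obtain ⟨u, hu⟩ := exists_star_center (r := fun x y => x ∈ X ∧ y ∈ Xᶜ ∧ G.Adj x y) (by
    rintro a a' b b' haa hbb ⟨ha, hb, hab⟩ ⟨ha', hb', hab'⟩
    exact not_two_cross hc h2 hG hH hAX hCY hXY hA hC hXA hYC hcross ha ha' hb hb' haa hbb hab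
      hab')
  have hd : Disjoint (X.erase u) (Xᶜ.erase u) :=
    Finset.disjoint_of_subset_left (Finset.erase_subset _ _)
      (Finset.disjoint_of_subset_right (Finset.erase_subset _ _) hXY)
  have hUU : ∀ x ∈ X.erase u, ∀ y ∈ Xᶜ.erase u, H.Adj x y := by
    intro x hx y hy
    have hne : x ≠ y := by
      rintro rfl
      exact Finset.disjoint_left.1 hd hx hy
    rw [Finset.mem_erase] at hx hy
    refine (hc x y hne).resolve_left fun h => ?_
    rcases hu x y ⟨hx.2, hy.2, h⟩ with h | h
    · exact hx.1 h
    · exact hy.1 h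
  have big : ∀ {S T : Finset V} {x y : V}, S ⊆ T → x ∈ T → y ∈ T → x ∉ S → y ∉ S → x ≠ y →
      S.card + 2 ≤ T.card := by
    intro S T x y hST hx hy hxS hyS hxy
    have e : (insert x (insert y S)).card = S.card + 2 := by
      rw [Finset.card_insert_of_notMem (by simp [hxy, hxS]), Finset.card_insert_of_notMem hyS]
    rw [← e]
    exact Finset.card_le_card (by simp [Finset.insert_subset_iff, hx, hy, hST])
  have cX := Finset.pred_card_le_card_erase (s := X) (a := u)
  have cY := Finset.pred_card_le_card_erase (s := Xᶜ) (a := u)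
  have cCY := Finset.card_le_card hCY
  refine ⟨u, X.erase u, Xᶜ.erase u, ?_, hd, by simp, by simp, ?_, ?_, hUU⟩
  · intro z
    simp only [Finset.mem_erase, Finset.mem_compl]
    tauto
  · intro x hx y hy hxy
    by_contra hxyG
    have hxyH := (hc x y hxy).resolve_left hxyG
    have hx' := Finset.mem_of_mem_erase hx
    have hy' := Finset.mem_of_mem_erase hy
    have := big hAX hx' hy' (fun h => hxyG (hXA y hy' x h hxy).symm)
      (fun h => hxyG (hXA x hx' y h hxy.symm)) hxy
    exact hH (hasCycle_odd_of_complete_bipartite (by omega) (by omega) (by omega) hd hUU hx hy hxyH)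
  · intro x hx y hy hxy
    by_contra hxyG
    have hxyH := (hc x y hxy).resolve_left hxyG
    have hx' := Finset.mem_of_mem_erase hx
    have hy' := Finset.mem_of_mem_erase hy
    have := big hCY hx' hy' (fun h => hxyG (hYC y hy' x h hxy).symm)
      (fun h => hxyG (hYC x hx' y h hxy.symm)) hxy
    -- The `H`-cycle needs `h` vertices on the other side, and `A` without `u` may fall short by
    -- one. The bound on `Xᶜ`, together with `3h + 2` vertices in all, makes `X` large enough.
    have hYle : Xᶜ.card ≤ 2 * h := by
      by_contra hlt
      have := Finset.card_sdiff_add_card_eq_card hCY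
      refine hG (hasCycle_odd_of_joined_clique (C := C) (D := Xᶜ \ C) cliqueC ?_
        Finset.sdiff_disjoint (by omega) hC (by omega))
      intro y hy c hcC
      rw [Finset.mem_sdiff] at hy
      exact hYC y hy.1 c hcC (by rintro rfl; exact hy.2 hcC)
    have := Finset.card_add_card_compl X
    exact hH (hasCycle_odd_of_complete_bipartite (by omega) (by omega) (by omega) hd.symm
      (fun x hx y hy => (hUU y hy x hx).symm) hx hy hxyH)

/-! ### From the cycle to the splitting, and the final count. -/

theorem splits_of_cycle [Fintype V] (hc : ∀ x y, x ≠ y → R.Adj x y ∨ B.Adj x y) {L : ℕ}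
    (hn : 4 ≤ n) (hV : 3 * n ≤ 2 * Fintype.card V) (hnL : n < L) (hL : HasCycle R L)
    (hR' : ¬ HasCycle R (L - 1)) (hB' : ¬ HasCycle B (L - 1)) (hR : ¬ HasCycle R n)
    (hB : ¬ HasCycle B n) : Splits B R := by
  rcases Nat.even_or_odd L with ⟨k, hk⟩ | hodd
  swap
  · exfalso
    rcases Nat.lt_or_ge L 7 with h7 | h7
    · have h5 : L = 5 := by
        obtain ⟨k, hk⟩ := hodd
        omega
      subst h5
      rcases hasCycle_four_of_five hc (by omega) hL with h | h
      · exact hR' h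
      · exact hB' h
    · rcases hasCycle_pred_of_odd hc hodd h7 hL with h | h
      · exact hR' h
      · exact hB' h
  obtain rfl : L = 2 * k := by omega
  obtain ⟨E, O, hEO, hE, hO, cE, cO, hcross⟩ :=
    exists_cliques_of_even_cycle hc (by omega) hL hR' hB'
  have : Nonempty V := Fintype.card_pos_iff.1 (by omega)
  obtain ⟨u, hu⟩ := exists_star_center (r := fun x y => x ∈ E ∧ y ∈ O ∧ B.Adj x y) (by
    rintro a a' b b' haa hbb ⟨ha, hb, hab⟩ ⟨ha', hb', hab'⟩
    exact hcross a ha a' ha' b hb b' hb' haa hbb hab hab')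
  have hR_cross : ∀ x ∈ E, ∀ y ∈ O, x ≠ u → y ≠ u → R.Adj x y := by
    intro x hx y hy hxu hyu
    refine (hc x y ?_).resolve_right fun h => ?_
    · rintro rfl
      exact Finset.disjoint_left.1 hEO hx hy
    · rcases hu x y ⟨hx, hy, h⟩ with h | h
      · exact hxu h
      · exact hyu h
  have cE' := Finset.pred_card_le_card_erase (s := E) (a := u)
  have cO' := Finset.pred_card_le_card_erase (s := O) (a := u)
  rcases Nat.even_or_odd n with ⟨m, hm⟩ | ⟨m, hm⟩
  · refine absurd ?_ hR
    rw [show n = 2 * m by omega]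
    refine hasCycle_of_complete_bipartite (P := E.erase u) (Q := O.erase u) (by omega) (by omega)
      (by omega) (Finset.disjoint_of_subset_left (Finset.erase_subset _ _)
      (Finset.disjoint_of_subset_right (Finset.erase_subset _ _) hEO)) ?_
    intro x hx y hy
    rw [Finset.mem_erase] at hx hy
    exact hR_cross x hx.2 y hy.2 hx.1 hy.1
  · subst hm
    have hc' : ∀ x y, x ≠ y → B.Adj x y ∨ R.Adj x y := fun x y h => (hc x y h).symm
    have sub : ∀ {S : Finset V}, (∀ x ∈ S, ∀ y ∈ S, x ≠ y → B.Adj x y) →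
        ∀ x ∈ S.erase u, ∀ y ∈ S.erase u, x ≠ y → B.Adj x y := fun hS x hx y hy =>
      hS x (Finset.mem_of_mem_erase hx) y (Finset.mem_of_mem_erase hy)
    by_cases huE : u ∈ E
    -- The clique that may lose the centre plays the role of `A`, where `m` vertices suffice; the
    -- other keeps its `k ≥ m + 1`.
    · refine splits_of_cliques hc' (h := m) (A := E.erase u) (C := O) (by omega) (by omega) hB hR
        (Finset.disjoint_of_subset_left (Finset.erase_subset _ _) hEO) (by omega) (by omega)
        (sub cE) cO ?_
      intro x hx y hy
      rw [Finset.mem_erase] at hx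
      exact hR_cross x hx.2 y hy hx.1 (by rintro rfl; exact Finset.disjoint_left.1 hEO huE hy)
    · refine splits_of_cliques hc' (h := m) (A := O.erase u) (C := E) (by omega) (by omega) hB hR
        (Finset.disjoint_of_subset_left (Finset.erase_subset _ _) hEO.symm) (by omega) (by omega)
        (sub cO) cE ?_
      intro x hx y hy
      rw [Finset.mem_erase] at hx
      exact (hR_cross y hy x hx.2 (by rintro rfl; exact huE hy) hx.1).symm

theorem splits_or_splits [Fintype V] (hc : ∀ x y, x ≠ y → R.Adj x y ∨ B.Adj x y) (hn : 4 ≤ n)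
    (hV : 3 * n ≤ 2 * Fintype.card V) (hR : ¬ HasCycle R n) (hB : ¬ HasCycle B n) :
    Splits R B ∨ Splits B R := by
  classical
  have hex := exists_long_cycle hc hn hV
  -- The least, not the greatest, length: minimality is what removes length `L - 1` from both
  -- colours.
  obtain ⟨hnL, hL⟩ := Nat.find_spec hex
  have hmin := fun m => Nat.find_min hex (m := m)
  generalize Nat.find hex = L at *
  have hlt : n < L := by
    refine lt_of_le_of_ne hnL ?_
    rintro rfl
    exact hL.elim hR hB
  have hpred := hmin (L - 1) (by omega)
  have hR' : ¬ HasCycle R (L - 1) := fun h => hpred ⟨by omega, Or.inl h⟩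
  have hB' : ¬ HasCycle B (L - 1) := fun h => hpred ⟨by omega, Or.inr h⟩
  rcases hL with hL | hL
  · exact Or.inr (splits_of_cycle hc hn hV hlt hL hR' hB' hR hB)
  · exact Or.inl (splits_of_cycle (fun x y h => (hc x y h).symm) hn hV hlt hL hB' hR' hB hR)

/-- A splitting, with the smaller class first and the edge sets written out. -/
theorem Splits.exists_classes [Fintype V] (hs : Splits G H)
    (hGH : ∀ x y, G.Adj x y → ¬ H.Adj x y) (hn : 2 ≤ n) (hG : ¬ HasCycle G n) :
    ∃ (u : V) (X Y : Finset V), X ∪ Y ∪ {u} = Finset.univ ∧ Disjoint X Y ∧ u ∉ X ∧ u ∉ Y ∧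
      X.card ≤ Y.card ∧ Y.card < n ∧ edgesAvoiding G u = pairs X ∪ pairs Y ∧
      edgesAvoiding H u = crossPairs X Y := by
  obtain ⟨u, X, Y, hcov, hd, huX, huY, cX, cY, hXY⟩ : ∃ (u : V) (X Y : Finset V),
      (∀ z, z ∈ X ∨ z ∈ Y ∨ z = u) ∧ Disjoint X Y ∧ u ∉ X ∧ u ∉ Y ∧
      (∀ x ∈ X, ∀ y ∈ X, x ≠ y → G.Adj x y) ∧ (∀ x ∈ Y, ∀ y ∈ Y, x ≠ y → G.Adj x y) ∧
      (∀ x ∈ X, ∀ y ∈ Y, H.Adj x y) ∧ X.card ≤ Y.card := by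
    obtain ⟨u, X, Y, hcov, hd, huX, huY, cX, cY, hXY⟩ := hs
    rcases le_total X.card Y.card with hle | hle
    · exact ⟨u, X, Y, hcov, hd, huX, huY, cX, cY, hXY, hle⟩
    · exact ⟨u, Y, X, fun z => by have := hcov z; tauto, hd.symm, huY, huX, cY, cX,
        fun x hx y hy => (hXY y hy x hx).symm, hle⟩
  obtain ⟨hXY, hle⟩ := hXY
  have hYn : Y.card < n := by
    by_contra hlt
    exact hG (hasCycle_of_clique hn (by omega) cY)
  refine ⟨u, X, Y, ?_, hd, huX, huY, hle, hYn, ?_, ?_⟩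
  · ext z
    have := hcov z
    simp only [Finset.mem_union, Finset.mem_singleton, Finset.mem_univ, iff_true]
    tauto
  · ext e
    constructor
    · induction e using Sym2.ind with
      | _ x y =>
        rintro ⟨hxy, hu⟩
        rw [SimpleGraph.mem_edgeSet] at hxy
        rw [Sym2.mem_iff, not_or] at hu
        rcases hcov x with hx | hx | hx <;> rcases hcov y with hy | hy | hy
        · exact Or.inl ⟨x, hx, y, hy, hxy.ne, rfl⟩
        · exact absurd (hXY x hx y hy) (hGH x y hxy)
        · exact absurd hy.symm hu.2
        · exact absurd (hXY y hy x hx) (hGH y x hxy.symm)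
        · exact Or.inr ⟨x, hx, y, hy, hxy.ne, rfl⟩
        · exact absurd hy.symm hu.2
        all_goals exact absurd hx.symm hu.1
    · rintro (⟨x, hx, y, hy, hxy, rfl⟩ | ⟨x, hx, y, hy, hxy, rfl⟩)
      · refine ⟨cX x hx y hy hxy, ?_⟩
        rw [Sym2.mem_iff]
        rintro (rfl | rfl)
        · exact huX hx
        · exact huX hy
      · refine ⟨cY x hx y hy hxy, ?_⟩
        rw [Sym2.mem_iff]
        rintro (rfl | rfl)
        · exact huY hx
        · exact huY hy
  · ext e
    constructor
    · induction e using Sym2.ind with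
      | _ x y =>
        rintro ⟨hxy, hu⟩
        rw [SimpleGraph.mem_edgeSet] at hxy
        rw [Sym2.mem_iff, not_or] at hu
        rcases hcov x with hx | hx | hx <;> rcases hcov y with hy | hy | hy
        · exact absurd hxy (hGH x y (cX x hx y hy hxy.ne))
        · exact ⟨x, hx, y, hy, rfl⟩
        · exact absurd hy.symm hu.2
        · exact ⟨y, hy, x, hx, Sym2.eq_swap⟩
        · exact absurd hxy (hGH x y (cY x hx y hy hxy.ne))
        · exact absurd hy.symm hu.2
        all_goals exact absurd hx.symm hu.1
    · rintro ⟨x, hx, y, hy, rfl⟩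
      refine ⟨hXY x hx y hy, ?_⟩
      rw [Sym2.mem_iff]
      rintro (rfl | rfl)
      · exact huX hx
      · exact huY hy

theorem IsTwoColoring.adj_or_adj {V : Type*} {R B : SimpleGraph V}
    (h : IsTwoColoring (SimpleGraph.completeGraph V) R B) (x y : V) (hxy : x ≠ y) :
    R.Adj x y ∨ B.Adj x y := by
  have : s(x, y) ∈ (SimpleGraph.completeGraph V).edgeSet := by simpa using hxy
  rw [h.1] at this
  exact this

theorem IsTwoColoring.not_adj {V : Type*} {G R B : SimpleGraph V} (h : IsTwoColoring G R B)
    (x y : V) (hxy : R.Adj x y) : ¬ B.Adj x y := fun hb =>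
  Set.disjoint_left.1 h.2 (show s(x, y) ∈ R.edgeSet from hxy) hb

end

end CycleRamsey


theorem theorem2 (n : ℕ) (hn : 4 ≤ n) (β : ℝ) (hβ : 0 < β)
    (hβn : β ≤ ((n / 2 : ℕ) : ℝ) / (n : ℝ))
    (R B : SimpleGraph (Fin ⌊(2 - β) * (n : ℝ)⌋₊))
    (hRB : CycleRamsey.IsTwoColoring (SimpleGraph.completeGraph (Fin ⌊(2 - β) * (n : ℝ)⌋₊)) R B)
    (hR : ¬ (SimpleGraph.cycleGraph n).IsContained R)
    (hB : ¬ (SimpleGraph.cycleGraph n).IsContained B) :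
    ∃ (u : Fin ⌊(2 - β) * (n : ℝ)⌋₊) (U₁ U₂ : Finset (Fin ⌊(2 - β) * (n : ℝ)⌋₊)),
      U₁ ∪ U₂ ∪ {u} = Finset.univ ∧ Disjoint U₁ U₂ ∧ u ∉ U₁ ∧ u ∉ U₂ ∧
      (1 - β) * (n : ℝ) - 1 < (U₁.card : ℝ) ∧ U₁.card ≤ U₂.card ∧ U₂.card < n ∧
      ((CycleRamsey.edgesAvoiding R u = CycleRamsey.pairs U₁ ∪ CycleRamsey.pairs U₂ ∧
          CycleRamsey.edgesAvoiding B u = CycleRamsey.crossPairs U₁ U₂) ∨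
        (CycleRamsey.edgesAvoiding B u = CycleRamsey.pairs U₁ ∪ CycleRamsey.pairs U₂ ∧
          CycleRamsey.edgesAvoiding R u = CycleRamsey.crossPairs U₁ U₂)) := by
  have hn0 : (0 : ℝ) < n := by
    have : 0 < n := by omega
    exact_mod_cast this
  have hβn' : β * n ≤ ((n / 2 : ℕ) : ℝ) := (le_div_iff₀ hn0).1 hβn
  have hV : 3 * n ≤ 2 * Fintype.card (Fin ⌊(2 - β) * (n : ℝ)⌋₊) := by
    -- The floor in the bound on `β` makes the left side an integer, so it survives rounding down.
    have : 2 * n - n / 2 ≤ ⌊(2 - β) * (n : ℝ)⌋₊ := by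
      apply Nat.le_floor
      rw [Nat.cast_sub (by omega)]
      push_cast at hβn' ⊢
      linarith
    rw [Fintype.card_fin]
    omega
  have hfloor := Nat.lt_floor_add_one ((2 - β) * (n : ℝ))
  have lower : ∀ (u : Fin ⌊(2 - β) * (n : ℝ)⌋₊) (U₁ U₂ : Finset (Fin ⌊(2 - β) * (n : ℝ)⌋₊)),
      U₁ ∪ U₂ ∪ {u} = Finset.univ → U₂.card < n →
      (1 - β) * (n : ℝ) - 1 < (U₁.card : ℝ) := by
    intro u U₁ U₂ hcov h2
    -- The deleted vertex and `U₂` together account for at most `n` vertices.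
    have h3 : ⌊(2 - β) * (n : ℝ)⌋₊ ≤ U₁.card + n := by
      have e := congrArg Finset.card hcov
      rw [Finset.card_univ, Fintype.card_fin] at e
      have l1 := Finset.card_union_le (U₁ ∪ U₂) {u}
      have l2 := Finset.card_union_le U₁ U₂
      rw [Finset.card_singleton] at l1
      omega
    have h4 : ((⌊(2 - β) * (n : ℝ)⌋₊ : ℕ) : ℝ) ≤ U₁.card + n := by exact_mod_cast h3
    linarith
  have hR' : ¬ CycleRamsey.HasCycle R n := fun h => hR h.isContained
  have hB' : ¬ CycleRamsey.HasCycle B n := fun h => hB h.isContained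
  rcases CycleRamsey.splits_or_splits hRB.adj_or_adj hn hV hR' hB' with hs | hs
  · obtain ⟨u, X, Y, hcov, hd, huX, huY, hle, hlt, hE, hE'⟩ :=
      hs.exists_classes hRB.not_adj (by omega) hR'
    exact ⟨u, X, Y, hcov, hd, huX, huY, lower u X Y hcov hlt, hle, hlt, Or.inl ⟨hE, hE'⟩⟩
  · obtain ⟨u, X, Y, hcov, hd, huX, huY, hle, hlt, hE, hE'⟩ :=
      hs.exists_classes (fun x y hb hr => hRB.not_adj x y hr hb) (by omega) hB'
    exact ⟨u, X, Y, hcov, hd, huX, huY, lower u X Y hcov hlt, hle, hlt, Or.inr ⟨hE, hE'⟩⟩
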